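/- A simple directed graph $G$ on vertex set $[n]=\{1,\dots,n\}$ (no loops, no parallel arcs; arcs in opposite directions are allowed) is given through quantum queries to its adjacency matrix, i.e. through the unitary $|v,w\rangle|b\rangle\mapsto|v,w\rangle|b\oplus[(v,w)\text{ is an arc of }G]\rangle$. For a (partial) decision problem on such graphs, let $\mathsf{Q}$ denote its bounded-error quantum query complexity (least number of queries of a quantum algorithm that errs with probability at most $1/3$ on every allowed input), viewed as a function of $n$. Let $s=1$ and $t=2$. Paths and cycles do not repeat vertices, and cycles have length at least $3$. For $k\ge 3$ consider the following problems. - $\mathtt{DirPath}_{s,t}^{=k}$ and $\mathtt{DirPath}_{s,t}^{\le k}$: decide whether $G$ has a directed path from $s$ to $t$ of length exactly $k$, respectively at most $k$. - $\mathtt{PromDirPath}_{s,t}^{=k}$ and $\mathtt{PromDirPath}_{s,t}^{\le k}$: the same problems, restricted to those $G$ for which, if there is any directed path from $s$ to $t$, there is one of length exactly $k$, respectively at most $k$. - $\mathtt{DirCycle}_{s}^{=k}$ and $\mathtt{DirCycle}_{s}^{\le k}$: decide whether $G$ has a directed cycle through $s$ of length exactly $k$, respectively at most $k$. - $\mathtt{PromDirCycle}_{s}^{=k}$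 and $\mathtt{PromDirCycle}_{s}^{\le k}$: the same problems, restricted to those $G$ for which, if there is any directed cycle through $s$, there is one of length exactly $k$, respectively at most $k$. Then for every constant integer $k\ge 3$ these eight problems have the same quantum query complexity up to constants: for any two problems $\mathtt{P},\mathtt{P}'$ among them, $\mathsf{Q}(\mathtt{P})\in\Theta(\mathsf{Q}(\mathtt{P}'))$ as $n\to\infty$, where the implied constants may depend on $k$. -/

import Mathlib

namespace QueryComplexity

/-! ### Partial Boolean functions and bounded-error quantum query complexity -/

/-- A decision problem on bit strings indexed by `I`, i.e. a partial Boolean function: the inputs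
are the elements of `dom`, and an input is a yes-instance iff it lies in `yes`. -/
structure Problem (I : Type) where
  dom : Set (I → Bool)
  yes : Set (I → Bool)

/-- The same problem, with the inputs further restricted by a promise. -/
def Problem.restrict {I : Type} (P : Problem I) (promise : Set (I → Bool)) : Problem I where
  dom := P.dom ∩ promise
  yes := P.yes

/-- A quantum query algorithm for inputs in `{0,1}^I`. Its state space has the orthonormal basis
`|i, b, z⟩` with `i : I` the query register, `b : Bool` the answer register and `z : W` a finite
workspace. It starts in a basis state, applies `U 0`, and then alternates `queries` times between a
call to the oracle and an input-independent unitary `U 1, U 2, …`. In the end the state is measured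
in the basis, and the algorithm accepts iff the outcome lies in `accept`. -/
structure QueryAlgorithm (I : Type) [Fintype I] [DecidableEq I] where
  W : Type
  [fintypeW : Fintype W]
  [decEqW : DecidableEq W]
  queries : ℕ
  init : I × Bool × W
  U : ℕ → Matrix.unitaryGroup (I × Bool × W) ℂ
  accept : Finset (I × Bool × W)

attribute [instance] QueryAlgorithm.fintypeW QueryAlgorithm.decEqW

/-- The oracle of the input `x`, the linear map with `|i, b, z⟩ ↦ |i, b ⊕ x i, z⟩`. (The amplitude
of `|i, b, z⟩` after the call is the amplitude of `|i, b ⊕ x i, z⟩` before it.) -/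
def oracle {I W : Type} (x : I → Bool) (ψ : I × Bool × W → ℂ) : I × Bool × W → ℂ :=
  fun s => ψ (s.1, xor s.2.1 (x s.1), s.2.2)

namespace QueryAlgorithm

variable {I : Type} [Fintype I] [DecidableEq I]

/-- The state on input `x` after `t` oracle calls and the unitary that follows the last of them. -/
def state (A : QueryAlgorithm I) (x : I → Bool) : ℕ → (I × Bool × A.W → ℂ)
  | 0 => Matrix.mulVec (A.U 0 : Matrix _ _ ℂ) (Pi.single A.init 1)
  | t + 1 => Matrix.mulVec (A.U (t + 1) : Matrix _ _ ℂ) (oracle x (A.state x t))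

/-- The probability that the algorithm accepts the input `x`. -/
noncomputable def acceptProb (A : QueryAlgorithm I) (x : I → Bool) : ℝ :=
  ∑ s ∈ A.accept, ‖A.state x A.queries s‖ ^ 2

/-- The algorithm solves `P` with error probability at most `1/3` on every input. -/
def Solves (A : QueryAlgorithm I) (P : Problem I) : Prop :=
  ∀ x ∈ P.dom, (x ∈ P.yes → 2 / 3 ≤ A.acceptProb x) ∧ (x ∉ P.yes → A.acceptProb x ≤ 1 / 3)

end QueryAlgorithm

/-- The (bounded-error) quantum query complexity of `P`: the least number of oracle calls of a
quantum query algorithm that solves `P`. -/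
noncomputable def Q {I : Type} [Fintype I] [DecidableEq I] (P : Problem I) : ℕ :=
  sInf {T : ℕ | ∃ A : QueryAlgorithm I, A.Solves P ∧ A.queries = T}

/-! ### Containment of directed subgraphs in the adjacency-matrix model -/

/-- A bit matrix with rows and columns indexed by the vertices `0, …, n - 1`. -/
abbrev AdjMatrix (n : ℕ) : Type := Fin n × Fin n → Bool

/-- The adjacency matrices of simple directed graphs: there are no loops, while opposite arcs
between two vertices may both be present. -/
def simpleDigraphs (n : ℕ) : Set (AdjMatrix n) := {x | ∀ v, x (v, v) = false}

/-- The graphs on `0, …, n - 1` that contain a copy of the directed graph `H` in which the marked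
vertices `v 0, v 1, …` of `H` are placed at the vertices `0, 1, …` respectively. -/
def contains {VH : Type} (H : Digraph VH) {m : ℕ} (v : Fin m → VH) (n : ℕ) : Set (AdjMatrix n) :=
  {x | ∃ φ : VH → Fin n, Function.Injective φ ∧ (∀ j, (φ (v j) : ℕ) = j) ∧
    ∀ a b, H.Adj a b → x (φ a, φ b) = true}

/-- The directed path with `l` arcs, from `0` to `l`. -/
def dirPathGraph (l : ℕ) : Digraph (Fin (l + 1)) where
  Adj i j := (i : ℕ) + 1 = j

/-- The directed cycle with `l` arcs. -/
def dirCycleGraph (l : ℕ) : Digraph (ZMod l) where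
  Adj i j := i + 1 = j

/-- The graphs with a directed path of length `l` from `s = 0` to `t = 1`. -/
def hasDirPath (l n : ℕ) : Set (AdjMatrix n) := contains (dirPathGraph l) ![0, Fin.last l] n

/-- The graphs with a directed cycle of length `l` through `s = 0`. -/
def hasDirCycle (l n : ℕ) : Set (AdjMatrix n) := contains (dirCycleGraph l) ![0] n

/-- Does the graph have a directed `s`-`t` path of length exactly `k`? -/
def DirPathEq (k n : ℕ) : Problem (Fin n × Fin n) where
  dom := simpleDigraphs n
  yes := hasDirPath k n

/-- Does the graph have a directed `s`-`t` path of length at most `k`? -/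
def DirPathLe (k n : ℕ) : Problem (Fin n × Fin n) where
  dom := simpleDigraphs n
  yes := {x | ∃ l, 1 ≤ l ∧ l ≤ k ∧ x ∈ hasDirPath l n}

/-- `DirPathEq`, promised that if there is a directed `s`-`t` path (of any length), then there is
one of length exactly `k`. -/
def PromDirPathEq (k n : ℕ) : Problem (Fin n × Fin n) :=
  (DirPathEq k n).restrict
    {x | (∃ l, 1 ≤ l ∧ x ∈ hasDirPath l n) → x ∈ hasDirPath k n}

/-- `DirPathLe`, promised that if there is a directed `s`-`t` path (of any length), then there is
one of length at most `k`. -/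
def PromDirPathLe (k n : ℕ) : Problem (Fin n × Fin n) :=
  (DirPathLe k n).restrict
    {x | (∃ l, 1 ≤ l ∧ x ∈ hasDirPath l n) → ∃ l, 1 ≤ l ∧ l ≤ k ∧ x ∈ hasDirPath l n}

/-- Does the graph have a directed cycle of length exactly `k` through `s`? -/
def DirCycleEq (k n : ℕ) : Problem (Fin n × Fin n) where
  dom := simpleDigraphs n
  yes := hasDirCycle k n

/-- Does the graph have a directed cycle of length at most `k` through `s`? Here and below, cycles
have length at least `3`. -/
def DirCycleLe (k n : ℕ) : Problem (Fin n × Fin n) where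
  dom := simpleDigraphs n
  yes := {x | ∃ l, 3 ≤ l ∧ l ≤ k ∧ x ∈ hasDirCycle l n}

/-- `DirCycleEq`, promised that if there is a directed cycle (of any length) through `s`, then
there is one of length exactly `k`. -/
def PromDirCycleEq (k n : ℕ) : Problem (Fin n × Fin n) :=
  (DirCycleEq k n).restrict
    {x | (∃ l, 3 ≤ l ∧ x ∈ hasDirCycle l n) → x ∈ hasDirCycle k n}

/-- `DirCycleLe`, promised that if there is a directed cycle (of any length) through `s`, then
there is one of length at most `k`. -/
def PromDirCycleLe (k n : ℕ) : Problem (Fin n × Fin n) :=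
  (DirCycleLe k n).restrict
    {x | (∃ l, 3 ≤ l ∧ x ∈ hasDirCycle l n) → ∃ l, 3 ≤ l ∧ l ≤ k ∧ x ∈ hasDirCycle l n}

end QueryComplexity

/-! A promise only makes a problem easier, so it suffices to reduce each of the four problems
without promise to each of the four promise problems, losing only a factor that depends on `k`.

The reduction is colour coding. Colour the vertices at random with `0, …, k`, move `s` to layer `0`
and `t` to layer `k`, and keep only arcs from a layer to the next. In such a graph every `s`-`t`
walk has length exactly `k` (`Layered.length_eq`), so "exactly" and "at most" agree and the promises
hold by themselves; identifying `t` with `s` turns these paths into cycles (`closeUp`). A path of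
length `l ≤ k`, or a cycle through `s`, is encoded as an `s`-`t` path of length `k`: layers at the
positions of `s` or `t` on the walk consist of copies of that vertex, and all arcs are put in from
layer `l` on. No-instances never acquire a path (`hasWalk_of_pull_layerSubst`), while yes-instances
keep one for a fraction at least `(k + 1)^(-(k + 1))` of the colourings
(`HasWalk.exists_colourings`).

Such a one-sided random reduction costs a constant factor in queries (`Reduces.exists_costs`): run
the algorithm on a uniform superposition of substituted inputs, amplifying before and after.
Products and superpositions of algorithms are formed with phase queries, which simulate bit queries
and conversely at no extra cost (`QueryAlgorithm.reach`, `Reach.bitReach`). -/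

namespace QueryComplexity

/-! ### Phase queries -/

/-- The substitution of bits of `x` and of constants given by `g`. -/
def pull {I I' : Type} (g : I' → I ⊕ Bool) (x : I → Bool) : I' → Bool :=
  fun j => Sum.elim x id (g j)

/-- The sign `(-1)^b`. -/
def sgn (b : Bool) : ℂ := if b then -1 else 1

lemma norm_sgn (b : Bool) : ‖sgn b‖ = 1 := by cases b <;> simp [sgn]

/-- Norm-preserving linear maps, i.e. unitaries. -/
def NormPres {S : Type} [Fintype S] (U : (S → ℂ) →ₗ[ℂ] (S → ℂ)) : Prop :=
  ∀ v, ∑ s, ‖U v s‖ ^ 2 = ∑ s, ‖v s‖ ^ 2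

/-- The states, as functions of the input, that can be prepared with `T` phase queries. -/
inductive Reach {I S : Type} [Fintype S] : ℕ → ((I → Bool) → S → ℂ) → Prop
  | const (v : S → ℂ) (hv : ∑ s, ‖v s‖ ^ 2 = 1) : Reach 0 (fun _ => v)
  | unitary {T : ℕ} {ψ : (I → Bool) → S → ℂ} (h : Reach T ψ) (U : (S → ℂ) →ₗ[ℂ] (S → ℂ))
      (hU : NormPres U) : Reach T (fun x => U (ψ x))
  | query {T : ℕ} {ψ : (I → Bool) → S → ℂ} (h : Reach T ψ) (idx : S → I ⊕ Bool) :
      Reach (T + 1) (fun x s => sgn (pull idx x s) * ψ x s)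

section Reach

variable {I I' S S' Ω : Type} [Fintype S] [Fintype S'] [Fintype Ω]

lemma Reach.norm_eq {T : ℕ} {ψ : (I → Bool) → S → ℂ} (h : Reach T ψ) (x : I → Bool) :
    ∑ s, ‖ψ x s‖ ^ 2 = 1 := by
  induction h with
  | const v hv => exact hv
  | unitary h U hU ih => rw [hU, ih]
  | query h idx ih => simpa [norm_sgn] using ih

/-- The map `U ⊗ 1`. -/
def onFst (U : (S → ℂ) →ₗ[ℂ] (S → ℂ)) : (S × S' → ℂ) →ₗ[ℂ] (S × S' → ℂ) where
  toFun v p := U (fun r => v (r, p.2)) p.1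
  map_add' v w := by
    ext p
    exact congrFun (U.map_add (fun r => v (r, p.2)) (fun r => w (r, p.2))) p.1
  map_smul' c v := by
    ext p
    exact congrFun (U.map_smul c (fun r => v (r, p.2))) p.1

/-- The map `1 ⊗ U`. -/
def onSnd (U : (S → ℂ) →ₗ[ℂ] (S → ℂ)) : (S' × S → ℂ) →ₗ[ℂ] (S' × S → ℂ) where
  toFun v p := U (fun r => v (p.1, r)) p.2
  map_add' v w := by
    ext p
    exact congrFun (U.map_add (fun r => v (p.1, r)) (fun r => w (p.1, r))) p.2
  map_smul' c v := by
    ext p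
    exact congrFun (U.map_smul c (fun r => v (p.1, r))) p.2

lemma NormPres.onFst {U : (S → ℂ) →ₗ[ℂ] (S → ℂ)} (hU : NormPres U) :
    NormPres (onFst (S' := S') U) := by
  intro v
  rw [Fintype.sum_prod_type_right, Fintype.sum_prod_type_right]
  exact Finset.sum_congr rfl fun s _ => hU fun r => v (r, s)

lemma NormPres.onSnd {U : (S → ℂ) →ₗ[ℂ] (S → ℂ)} (hU : NormPres U) :
    NormPres (onSnd (S' := S') U) := by
  intro v
  rw [Fintype.sum_prod_type, Fintype.sum_prod_type]
  exact Finset.sum_congr rfl fun s _ => hU fun r => v (s, r)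

lemma sum_norm_mul_sq (u : S → ℂ) (v : S' → ℂ) (hu : ∑ s, ‖u s‖ ^ 2 = 1)
    (hv : ∑ s, ‖v s‖ ^ 2 = 1) : ∑ p : S × S', ‖u p.1 * v p.2‖ ^ 2 = 1 := by
  simp_rw [norm_mul, mul_pow, Fintype.sum_prod_type, ← Finset.mul_sum, hv, mul_one, hu]

/-- Each step of either algorithm acts on its own tensor factor, so the two can be run one after the
other. The outer induction unwinds the second algorithm, the inner one the first. -/
lemma Reach.prod {T T' : ℕ} {ψ : (I → Bool) → S → ℂ} {φ : (I → Bool) → S' → ℂ}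
    (h : Reach T ψ) (h' : Reach T' φ) :
    Reach (T + T') (fun x (p : S × S') => ψ x p.1 * φ x p.2) := by
  induction h' with
  | const w hw =>
    induction h with
    | const v hv => exact .const _ (sum_norm_mul_sq v w hv hw)
    | @unitary T ψ h U hU ih =>
      convert ih.unitary (QueryComplexity.onFst U) hU.onFst using 1
      ext x p
      have := congrFun (U.map_smul (w p.2) (ψ x)) p.1
      simp only [Pi.smul_apply, smul_eq_mul] at this
      rw [mul_comm, ← this]
      simp only [QueryComplexity.onFst, LinearMap.coe_mk, AddHom.coe_mk]
      exact congrFun (congrArg U (funext fun r => mul_comm _ _)) p.1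
    | @query T ψ h idx ih =>
      convert ih.query (fun p => idx p.1) using 1
      ext x p
      simp [pull, mul_assoc]
  | @unitary T' φ h' U hU ih =>
    convert ih.unitary (QueryComplexity.onSnd U) hU.onSnd using 1
    ext x p
    exact (congrFun (U.map_smul (ψ x p.1) (φ x)) p.2).symm
  | @query T' φ h' idx ih =>
    rw [← add_assoc]
    convert ih.query (fun p => idx p.2) using 1
    ext x p
    simp [pull, mul_left_comm]

/-- Run an algorithm on a superposition of substituted inputs. -/
lemma Reach.superpose {T : ℕ} {ψ : (I' → Bool) → S → ℂ} (h : Reach T ψ) (c : Ω → ℂ)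
    (hc : ∑ ω, ‖c ω‖ ^ 2 = 1) (g : Ω → I' → I ⊕ Bool) :
    Reach T (fun x (p : Ω × S) => c p.1 * ψ (pull (g p.1) x) p.2) := by
  induction h with
  | const v hv => exact .const _ (sum_norm_mul_sq c v hc hv)
  | @unitary T ψ h U hU ih =>
    convert ih.unitary (QueryComplexity.onSnd U) hU.onSnd using 1
    ext x p
    exact (congrFun (U.map_smul (c p.1) (ψ (pull (g p.1) x))) p.2).symm
  | @query T ψ h idx ih =>
    convert ih.query (fun p => Sum.elim (g p.1) Sum.inr (idx p.2)) using 1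
    ext x p
    have : pull idx (pull (g p.1) x) p.2
        = pull (fun p : Ω × S => Sum.elim (g p.1) Sum.inr (idx p.2)) x p := by
      simp only [pull]
      cases idx p.2 <;> simp [pull]
    simp only [this, mul_left_comm]

end Reach

/-! ### Phase queries versus bit queries -/

section Convert

variable {I W : Type} [Fintype I] [DecidableEq I] [Fintype W] [DecidableEq W]

/-- The evolution of the state of a query algorithm. -/
def run (init : I × Bool × W) (U : ℕ → Matrix.unitaryGroup (I × Bool × W) ℂ) (x : I → Bool) :
    ℕ → (I × Bool × W → ℂ)
  | 0 => Matrix.mulVec (U 0 : Matrix _ _ ℂ) (Pi.single init 1)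
  | t + 1 => Matrix.mulVec (U (t + 1) : Matrix _ _ ℂ) (oracle x (run init U x t))

lemma QueryAlgorithm.state_eq_run (A : QueryAlgorithm I) (x : I → Bool) (t : ℕ) :
    A.state x t = run A.init A.U x t := by
  induction t with
  | zero => rfl
  | succ t ih => rw [QueryAlgorithm.state, run, ih]

lemma run_congr (init : I × Bool × W) {U V : ℕ → Matrix.unitaryGroup (I × Bool × W) ℂ}
    (x : I → Bool) {t : ℕ} (h : ∀ r ≤ t, U r = V r) : run init U x t = run init V x t := by
  induction t with
  | zero => rw [run, run, h 0 le_rfl]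
  | succ t ih => rw [run, run, h (t + 1) le_rfl, ih fun r hr => h r (by omega)]

/-- The states that a query algorithm with workspace `W` can reach with `T` oracle calls. -/
def BitReach (T : ℕ) (Ψ : (I → Bool) → I × Bool × W → ℂ) : Prop :=
  ∃ init U, ∀ x, run init U x T = Ψ x

lemma NormPres.inner_eq {S : Type} [Fintype S] {V : (S → ℂ) →ₗ[ℂ] (S → ℂ)}
    (hV : NormPres V) (v w : S → ℂ) : star (V v) ⬝ᵥ V w = star v ⬝ᵥ w := by
  let f : EuclideanSpace ℂ S →ₗ[ℂ] EuclideanSpace ℂ S :=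
    (WithLp.linearEquiv 2 ℂ (S → ℂ)).symm.toLinearMap ∘ₗ V ∘ₗ
      (WithLp.linearEquiv 2 ℂ (S → ℂ)).toLinearMap
  have hf : ∀ u, ‖f u‖ = ‖u‖ := by
    intro u
    rw [EuclideanSpace.norm_eq, EuclideanSpace.norm_eq]
    congr 1
    exact hV (WithLp.ofLp u)
  let F : EuclideanSpace ℂ S →ₗᵢ[ℂ] EuclideanSpace ℂ S := ⟨f, hf⟩
  have := F.inner_map_map (WithLp.toLp 2 v) (WithLp.toLp 2 w)
  rw [EuclideanSpace.inner_eq_star_dotProduct, EuclideanSpace.inner_eq_star_dotProduct] at this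
  rw [dotProduct_comm, dotProduct_comm (star v)]
  exact this

lemma NormPres.exists_unitary {S : Type} [Fintype S] [DecidableEq S]
    {V : (S → ℂ) →ₗ[ℂ] (S → ℂ)} (hV : NormPres V) :
    ∃ M : Matrix.unitaryGroup S ℂ, ∀ v, (M : Matrix S S ℂ).mulVec v = V v := by
  refine ⟨⟨LinearMap.toMatrix' V, ?_⟩, fun v => LinearMap.toMatrix'_mulVec V v⟩
  rw [Matrix.mem_unitaryGroup_iff']
  ext i j
  have := hV.inner_eq (Pi.single i 1) (Pi.single j 1)
  rw [Matrix.star_eq_conjTranspose, Matrix.mul_apply]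
  simp only [Matrix.conjTranspose_apply, LinearMap.toMatrix'_apply]
  rw [dotProduct] at this
  simp only [Pi.star_apply] at this
  convert this using 1
  simp [Matrix.one_apply, dotProduct, Pi.single_apply, apply_ite star, eq_comm]

/-- Extend `v` to an orthonormal basis having `v` at index `s`, and map the standard basis to it. -/
lemma exists_normPres_single {S : Type} [Fintype S] [DecidableEq S] (s : S) (v : S → ℂ)
    (hv : ∑ s, ‖v s‖ ^ 2 = 1) :
    ∃ V : (S → ℂ) →ₗ[ℂ] (S → ℂ), NormPres V ∧ V (Pi.single s 1) = v := by
  have hn : ‖WithLp.toLp 2 v‖ = 1 := by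
    rw [EuclideanSpace.norm_eq]
    simp [hv]
  have ho : Orthonormal ℂ (({s} : Set S).domRestrict fun _ : S => WithLp.toLp 2 v) := by
    refine ⟨fun _ => hn, fun i j hij => (hij (Subsingleton.elim i j)).elim⟩
  obtain ⟨b, hb⟩ := ho.exists_orthonormalBasis_extension_of_card_eq (ι := S) (by simp)
  let e := (EuclideanSpace.basisFun S ℂ).equiv b (Equiv.refl S)
  refine ⟨(WithLp.linearEquiv 2 ℂ (S → ℂ)).toLinearMap ∘ₗ e.toLinearEquiv.toLinearMap ∘ₗ
      (WithLp.linearEquiv 2 ℂ (S → ℂ)).symm.toLinearMap, fun w => ?_, ?_⟩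
  · have := e.norm_map (WithLp.toLp 2 w)
    rw [EuclideanSpace.norm_eq, EuclideanSpace.norm_eq,
      Real.sqrt_inj (by positivity) (by positivity)] at this
    exact this
  · have h1 : e (WithLp.toLp 2 (Pi.single s 1)) = WithLp.toLp 2 v := by
      have := (EuclideanSpace.basisFun S ℂ).equiv_apply_basis b (Equiv.refl S) s
      rw [EuclideanSpace.basisFun_apply] at this
      rw [← hb s rfl]
      exact this
    exact congrArg WithLp.ofLp h1

lemma BitReach.const (v : I × Bool × W → ℂ) (hv : ∑ s, ‖v s‖ ^ 2 = 1) :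
    BitReach 0 (fun _ => v) := by
  obtain ⟨s⟩ : Nonempty (I × Bool × W) := by
    by_contra h
    rw [not_nonempty_iff] at h
    simp at hv
  obtain ⟨V, hV, hVs⟩ := exists_normPres_single s v hv
  obtain ⟨M, hM⟩ := hV.exists_unitary
  exact ⟨s, fun _ => M, fun x => by rw [run, hM, hVs]⟩

/-- The extra unitary is absorbed into the last one, `U T`. -/
lemma BitReach.unitary {T : ℕ} {Ψ : (I → Bool) → I × Bool × W → ℂ} (h : BitReach T Ψ)
    {V : (I × Bool × W → ℂ) →ₗ[ℂ] (I × Bool × W → ℂ)} (hV : NormPres V) :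
    BitReach T (fun x => V (Ψ x)) := by
  obtain ⟨init, U, hU⟩ := h
  obtain ⟨M, hM⟩ := hV.exists_unitary
  refine ⟨init, Function.update U T (M * U T), fun x => ?_⟩
  simp only [← hU x, ← hM]
  cases T with
  | zero => simp only [run, Function.update_self, Matrix.mulVec_mulVec, Submonoid.coe_mul]
  | succ T =>
    rw [run, run, run_congr init (V := U) x fun r hr =>
      Function.update_of_ne (by omega) _ _]
    simp

lemma BitReach.oracle {T : ℕ} {Ψ : (I → Bool) → I × Bool × W → ℂ} (h : BitReach T Ψ) :
    BitReach (T + 1) (fun x => oracle x (Ψ x)) := by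
  obtain ⟨init, U, hU⟩ := h
  refine ⟨init, Function.update U (T + 1) 1, fun x => ?_⟩
  rw [run, run_congr init (V := U) x fun r hr => Function.update_of_ne (by omega) _ _, hU]
  simp

/-- The Hadamard transform of the answer register. -/
noncomputable def hadamard : (I × Bool × W → ℂ) →ₗ[ℂ] (I × Bool × W → ℂ) where
  toFun v p := (v (p.1, false, p.2.2) + sgn p.2.1 * v (p.1, true, p.2.2)) / (Real.sqrt 2 : ℝ)
  map_add' v w := by
    ext p
    simp only [Pi.add_apply]
    ring
  map_smul' c v := by
    ext p
    simp only [Pi.smul_apply, smul_eq_mul, RingHom.id_apply]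
    ring

lemma parallelogram_half (a b : ℂ) :
    ‖(a + b) / (Real.sqrt 2 : ℝ)‖ ^ 2 + ‖(a - b) / (Real.sqrt 2 : ℝ)‖ ^ 2
      = ‖a‖ ^ 2 + ‖b‖ ^ 2 := by
  have := parallelogram_law_with_norm ℝ a b
  have h2 : (Real.sqrt 2) ^ 2 = 2 := Real.sq_sqrt (by norm_num)
  rw [norm_div, norm_div, div_pow, div_pow, Complex.norm_real, Real.norm_eq_abs, sq_abs, h2]
  linarith

omit [DecidableEq I] [DecidableEq W] in
lemma normPres_hadamard : NormPres (hadamard (I := I) (W := W)) := by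
  intro v
  simp only [Fintype.sum_prod_type, Fintype.sum_bool]
  refine Finset.sum_congr rfl fun i _ => ?_
  rw [← Finset.sum_add_distrib, ← Finset.sum_add_distrib]
  refine Finset.sum_congr rfl fun w _ => ?_
  have := parallelogram_half (v (i, false, w)) (v (i, true, w))
  simp only [hadamard, LinearMap.coe_mk, AddHom.coe_mk, if_true, sgn, neg_one_mul, one_mul,
    Bool.false_eq_true, if_false]
  rw [← sub_eq_add_neg]
  linarith

lemma sqrt_two_mul_self : ((Real.sqrt 2 : ℝ) : ℂ) * (Real.sqrt 2 : ℝ) = 2 := by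
  rw [← Complex.ofReal_mul, Real.mul_self_sqrt (by norm_num)]
  norm_num

omit [Fintype I] [DecidableEq I] [Fintype W] [DecidableEq W] in
/-- A bit query is a phase query between two Hadamard transforms. -/
lemma oracle_eq_hadamard (x : I → Bool) (v : I × Bool × W → ℂ) :
    oracle x v = hadamard (fun p =>
      sgn (pull (fun p : I × Bool × W => if p.2.1 then Sum.inl p.1 else Sum.inr false) x p) *
        hadamard v p) := by
  have h2 := sqrt_two_mul_self
  have h0 : ((Real.sqrt 2 : ℝ) : ℂ) ≠ 0 := by
    intro h
    rw [h] at h2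
    norm_num at h2
  ext ⟨i, b, w⟩
  simp only [oracle, hadamard, LinearMap.coe_mk, AddHom.coe_mk, pull, if_true]
  cases b <;> cases hx : x i <;> simp [sgn, hx] <;> field_simp <;> rw [pow_two, h2] <;> ring

/-- By `oracle_eq_hadamard`, every oracle call is a single phase query up to unitaries. -/
lemma QueryAlgorithm.reach (A : QueryAlgorithm I) (t : ℕ) : Reach t (fun x => A.state x t) := by
  have hU : ∀ M : Matrix.unitaryGroup (I × Bool × A.W) ℂ,
      NormPres (Matrix.mulVecLin (M : Matrix (I × Bool × A.W) (I × Bool × A.W) ℂ)) := by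
    intro M v
    have hM : star (M : Matrix (I × Bool × A.W) (I × Bool × A.W) ℂ) * M = 1 :=
      Matrix.mem_unitaryGroup_iff'.1 M.2
    have key : ∀ w : I × Bool × A.W → ℂ, ((∑ s, ‖w s‖ ^ 2 : ℝ) : ℂ) = star w ⬝ᵥ w := by
      intro w
      simp [dotProduct, ← Complex.conj_mul']
    have : star (Matrix.mulVec (M : Matrix (I × Bool × A.W) (I × Bool × A.W) ℂ) v) ⬝ᵥ
        Matrix.mulVec (M : Matrix (I × Bool × A.W) (I × Bool × A.W) ℂ) v = star v ⬝ᵥ v := by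
      rw [Matrix.star_mulVec, Matrix.dotProduct_mulVec, Matrix.vecMul_vecMul,
        ← Matrix.star_eq_conjTranspose, hM, Matrix.vecMul_one]
    rw [← key, ← key] at this
    exact_mod_cast this
  induction t with
  | zero =>
    refine (Reach.const (Pi.single A.init 1) ?_).unitary _ (hU (A.U 0))
    simp [Pi.single_apply, apply_ite norm, ite_pow]
  | succ t ih =>
    have := (((ih.unitary _ normPres_hadamard).query
      (fun p : I × Bool × A.W => if p.2.1 then Sum.inl p.1 else Sum.inr false)).unitary _
      normPres_hadamard).unitary _ (hU (A.U (t + 1)))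
    simp only [← oracle_eq_hadamard] at this
    exact this

/-- Permuting the query and answer registers and changing signs, depending on the workspace. -/
def permute (e : W → Equiv.Perm (I × Bool)) (d : W → Bool) :
    (I × Bool × W → ℂ) →ₗ[ℂ] (I × Bool × W → ℂ) where
  toFun v p := sgn (d p.2.2) *
    v ((e p.2.2 (p.1, p.2.1)).1, (e p.2.2 (p.1, p.2.1)).2, p.2.2)
  map_add' v w := by
    ext p
    simp only [Pi.add_apply]
    ring
  map_smul' c v := by
    ext p
    simp only [Pi.smul_apply, smul_eq_mul, RingHom.id_apply]
    ring

omit [DecidableEq I] [DecidableEq W] in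
lemma normPres_permute (e : W → Equiv.Perm (I × Bool)) (d : W → Bool) :
    NormPres (permute e d) := by
  intro v
  rw [← Equiv.sum_comp (Equiv.prodAssoc I Bool W), ← Equiv.sum_comp (Equiv.prodAssoc I Bool W),
    Fintype.sum_prod_type_right, Fintype.sum_prod_type_right]
  refine Finset.sum_congr rfl fun w _ => ?_
  simpa [permute, norm_sgn] using Equiv.sum_comp (e w) fun q => ‖v (q.1, q.2, w)‖ ^ 2

/-- Phase kickback. The state `ψ` is kept in the workspace, with the query and answer registers
parked at `(i₀, false)` between queries. -/
lemma Reach.bitReach {T : ℕ} {ψ : (I → Bool) → W → ℂ} (h : Reach T ψ) (i₀ : I) :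
    BitReach T (fun (x : I → Bool) (p : I × Bool × W) => if p.1 = i₀ ∧ p.2.1 = false then ψ x p.2.2 else 0) := by
  have hs : ∀ v : W → ℂ, ∑ p : I × Bool × W,
      ‖if p.1 = i₀ ∧ p.2.1 = false then v p.2.2 else 0‖ ^ 2 = ∑ s, ‖v s‖ ^ 2 := by
    intro v
    simp only [Fintype.sum_prod_type, Fintype.sum_bool]
    rw [Finset.sum_eq_single i₀]
    · simp
    · intro i _ hi
      simp [hi]
    · simp
  induction h with
  | const v hv => exact .const _ (by rw [hs, hv])
  | @unitary T ψ h U hU ih =>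
    have hU' : NormPres (onSnd (S' := I) (onSnd (S' := Bool) U)) := hU.onSnd.onSnd
    convert ih.unitary hU' using 1
    ext x p
    simp only [onSnd, LinearMap.coe_mk, AddHom.coe_mk]
    by_cases hp : p.1 = i₀ ∧ p.2.1 = false
    · simp only [hp, and_self, if_true]
    · simp only [hp, if_false]
      exact (congrFun U.map_zero p.2.2).symm
  | @query T ψ h idx ih =>
    -- If `w` queries the bit `j`, the involution `e w` moves `(i₀, false)` to `(j, true)`, and the
    -- Hadamard transform makes the answer register an eigenvector of the oracle with eigenvalue the
    -- sign of `x j`. If `w` queries a constant, the answer register is unaffected by the oracle and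
    -- `d` supplies the sign.
    let e : W → Equiv.Perm (I × Bool) := fun w =>
      Sum.elim (fun j => (Equiv.swap i₀ j).prodCongr Equiv.boolNot) (fun _ => 1) (idx w)
    let d : W → Bool := fun w => Sum.elim (fun _ => false) id (idx w)
    have h2 := sqrt_two_mul_self
    have h0 : ((Real.sqrt 2 : ℝ) : ℂ) ≠ 0 := by
      intro h
      rw [h] at h2
      norm_num at h2
    have := ((((ih.unitary (normPres_permute e d)).unitary normPres_hadamard).oracle).unitary
      normPres_hadamard).unitary (normPres_permute e fun _ => false)
    convert this using 1
    ext x ⟨i, b, w⟩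
    simp only [permute, hadamard, oracle, LinearMap.coe_mk, AddHom.coe_mk, pull, d, e]
    rcases idx w with j | c
    · by_cases hi : i = i₀
      · subst hi
        cases b <;> cases hx : x j <;> simp [sgn, hx] <;> field_simp <;> rw [pow_two, h2] <;> ring
      · simp [hi]
    · by_cases hi : i = i₀
      · subst hi
        cases b <;> cases c <;> cases hx : x i <;> simp [sgn, hx] <;> field_simp <;> rw [pow_two, h2] <;> ring
      · simp [hi]

end Convert

end QueryComplexity

namespace QueryComplexity

/-! ### Acceptance probabilities -/

/-- The acceptance probabilities, as functions of the input, of algorithms with `T` queries. -/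
def Acc {I : Type} (T : ℕ) (p : (I → Bool) → ℝ) : Prop :=
  ∃ (S : Type) (_ : Fintype S) (ψ : (I → Bool) → S → ℂ) (F : Finset S), Reach T ψ ∧
    ∀ x, p x = ∑ s ∈ F, ‖ψ x s‖ ^ 2

section Acc

variable {I I' Ω : Type}

lemma QueryAlgorithm.acc [Fintype I] [DecidableEq I] (A : QueryAlgorithm I) :
    Acc A.queries A.acceptProb :=
  ⟨_, inferInstance, _, A.accept, A.reach A.queries, fun _ => rfl⟩

lemma Acc.exists_queryAlgorithm [Fintype I] [DecidableEq I] [Nonempty I] {T : ℕ}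
    {p : (I → Bool) → ℝ} (h : Acc T p) :
    ∃ A : QueryAlgorithm I, A.queries = T ∧ ∀ x, A.acceptProb x = p x := by
  classical
  obtain ⟨S, _, ψ, F, hψ, hp⟩ := h
  let i₀ : I := Classical.arbitrary I
  obtain ⟨init, U, hU⟩ := hψ.bitReach i₀
  refine ⟨{ W := S, queries := T, init := init, U := U, accept := {i₀} ×ˢ {false} ×ˢ F }, rfl,
    fun x => ?_⟩
  rw [hp, QueryAlgorithm.acceptProb]
  simp only [QueryAlgorithm.state_eq_run, hU, Finset.sum_product, Finset.sum_singleton,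
    and_self, if_true]

lemma Acc.nonneg {T : ℕ} {p : (I → Bool) → ℝ} (h : Acc T p) (x : I → Bool) : 0 ≤ p x := by
  obtain ⟨S, _, ψ, F, hψ, hp⟩ := h
  rw [hp]
  positivity

lemma Acc.compl {T : ℕ} {p : (I → Bool) → ℝ} (h : Acc T p) : Acc T fun x => 1 - p x := by
  classical
  obtain ⟨S, _, ψ, F, hψ, hp⟩ := h
  refine ⟨S, _, ψ, Fᶜ, hψ, fun x => ?_⟩
  simp only [hp]
  rw [← hψ.norm_eq x, ← Finset.sum_add_sum_compl F]
  ring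

lemma Acc.le_one {T : ℕ} {p : (I → Bool) → ℝ} (h : Acc T p) (x : I → Bool) : p x ≤ 1 := by
  have := h.compl.nonneg x
  linarith

lemma Acc.one : Acc 0 fun _ : I → Bool => 1 :=
  ⟨Unit, inferInstance, _, Finset.univ, .const (fun _ => 1) (by simp), by simp⟩

lemma Acc.mul {T T' : ℕ} {p q : (I → Bool) → ℝ} (h : Acc T p) (h' : Acc T' q) :
    Acc (T + T') fun x => p x * q x := by
  obtain ⟨S, _, ψ, F, hψ, hp⟩ := h
  obtain ⟨S', _, ψ', F', hψ', hp'⟩ := h'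
  refine ⟨S × S', inferInstance, _, F ×ˢ F', hψ.prod hψ', fun x => ?_⟩
  simp_rw [hp, hp', Finset.sum_mul_sum, Finset.sum_product, norm_mul, mul_pow]

lemma Acc.pow {T : ℕ} {p : (I → Bool) → ℝ} (h : Acc T p) (m : ℕ) :
    Acc (m * T) fun x => p x ^ m := by
  induction m with
  | zero => simpa using Acc.one
  | succ m ih => simpa [pow_succ, Nat.succ_mul] using ih.mul h

/-- The register `Ω` starts in uniform superposition and only serves as a control, so its branches
do not interfere and their acceptance probabilities are averaged. -/
lemma Acc.average [Fintype Ω] [Nonempty Ω] {T : ℕ} {p : (I' → Bool) → ℝ} (h : Acc T p)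
    (g : Ω → I' → I ⊕ Bool) :
    Acc T fun x => (∑ ω, p (pull (g ω) x)) / Fintype.card Ω := by
  obtain ⟨S, _, ψ, F, hψ, hp⟩ := h
  have hΩ : (0 : ℝ) < Fintype.card Ω := by exact_mod_cast Fintype.card_pos
  have hc : ‖((1 / Real.sqrt (Fintype.card Ω) : ℝ) : ℂ)‖ ^ 2 = 1 / Fintype.card Ω := by
    rw [Complex.norm_real, Real.norm_eq_abs, sq_abs, div_pow, Real.sq_sqrt hΩ.le, one_pow]
  refine ⟨Ω × S, inferInstance, _, Finset.univ ×ˢ F,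
    hψ.superpose (fun _ => ((1 / Real.sqrt (Fintype.card Ω) : ℝ) : ℂ)) ?_ g, fun x => ?_⟩
  · rw [Finset.sum_congr rfl fun ω _ => hc]
    simp [hΩ.ne']
  · simp_rw [hp, Finset.sum_product, norm_mul, mul_pow, hc, ← Finset.mul_sum]
    ring

/-- An OR of ANDs widens any gap between acceptance probabilities. -/
lemma exists_or_and {a b ε : ℝ} (ha : 0 ≤ a) (hab : a < b) (hb : b ≤ 1) (hε : 0 < ε) :
    ∃ m l : ℕ, ∀ p : ℝ, 0 ≤ p → p ≤ 1 →
      (p ≤ a → 1 - (1 - p ^ m) ^ l ≤ ε) ∧ (b ≤ p → 1 - ε ≤ 1 - (1 - p ^ m) ^ l) := by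
  have hb0 : 0 < b := ha.trans_lt hab
  obtain ⟨t, ht⟩ : ∃ t : ℕ, Real.exp (-t) ≤ ε := by
    have : Filter.Tendsto (fun t : ℕ => Real.exp (-t)) Filter.atTop (nhds 0) :=
      Real.tendsto_exp_neg_atTop_nhds_zero.comp tendsto_natCast_atTop_atTop
    exact (this.eventually (ge_mem_nhds hε)).exists
  obtain ⟨m, hm⟩ : ∃ m : ℕ, (t + 1) * (a / b) ^ m ≤ ε := by
    have := (tendsto_pow_atTop_nhds_zero_of_lt_one (div_nonneg ha hb0.le)
      ((div_lt_one hb0).2 hab)).const_mul (t + 1 : ℝ)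
    rw [mul_zero] at this
    exact (this.eventually (ge_mem_nhds hε)).exists
  have hbm : 0 < b ^ m := by positivity
  have hbm1 : b ^ m ≤ 1 := pow_le_one₀ hb0.le hb
  -- With `l = ⌈t / b ^ m⌉₊`, the union bound gives `l * a ^ m ≤ (t + 1) * (a / b) ^ m ≤ ε` for
  -- small `p`, while `l * b ^ m ≥ t` gives failure at most `exp (-t) ≤ ε` for large `p`.
  refine ⟨m, ⌈t / b ^ m⌉₊, fun p hp0 hp1 => ⟨fun hpa => ?_, fun hpb => ?_⟩⟩
  · have hpm : p ^ m ≤ a ^ m := pow_le_pow_left₀ hp0 hpa m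
    have hpm1 : p ^ m ≤ 1 := pow_le_one₀ hp0 hp1
    have hpm0 : 0 ≤ p ^ m := by positivity
    have h1 := one_add_mul_le_pow (a := -p ^ m) (by linarith) ⌈t / b ^ m⌉₊
    have h2 : (⌈t / b ^ m⌉₊ : ℝ) < t / b ^ m + 1 := Nat.ceil_lt_add_one (by positivity)
    have h3 : (⌈t / b ^ m⌉₊ : ℝ) ≤ (t + 1) / b ^ m := by
      refine h2.le.trans ?_
      rw [add_div]
      gcongr
      exact (one_le_div hbm).2 hbm1
    have h4 : (⌈t / b ^ m⌉₊ : ℝ) * p ^ m ≤ (t + 1) / b ^ m * a ^ m := by gcongr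
    have h5 : (t + 1) / b ^ m * a ^ m = (t + 1) * (a / b) ^ m := by
      rw [div_pow]
      ring
    rw [← sub_eq_add_neg] at h1
    linarith
  · have hpm : b ^ m ≤ p ^ m := pow_le_pow_left₀ hb0.le hpb m
    have hpm1 : p ^ m ≤ 1 := pow_le_one₀ hp0 hp1
    have h1 : (1 - p ^ m) ^ ⌈t / b ^ m⌉₊ ≤ Real.exp (-b ^ m) ^ ⌈t / b ^ m⌉₊ := by
      refine pow_le_pow_left₀ (by linarith) ?_ _
      have := Real.add_one_le_exp (-b ^ m)
      linarith
    have h2 : Real.exp (-b ^ m) ^ ⌈t / b ^ m⌉₊ ≤ Real.exp (-t) := by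
      rw [← Real.exp_nat_mul, Real.exp_le_exp]
      have := Nat.le_ceil ((t : ℝ) / b ^ m)
      rw [div_le_iff₀ hbm] at this
      linarith
    linarith

/-- Amplification. -/
lemma exists_amplify {a b ε : ℝ} (ha : 0 ≤ a) (hab : a < b) (hb : b ≤ 1) (hε : 0 < ε) :
    ∃ C : ℕ, ∀ (I : Type) (T : ℕ) (p : (I → Bool) → ℝ), Acc T p →
      ∃ q : (I → Bool) → ℝ, Acc (C * T) q ∧
        ∀ x, (p x ≤ a → q x ≤ ε) ∧ (b ≤ p x → 1 - ε ≤ q x) := by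
  obtain ⟨m, l, h⟩ := exists_or_and ha hab hb hε
  refine ⟨l * m, fun I T p hp => ⟨fun x => 1 - (1 - p x ^ m) ^ l, ?_, fun x =>
    h (p x) (hp.nonneg x) (hp.le_one x)⟩⟩
  rw [mul_assoc]
  exact ((hp.pow m).compl.pow l).compl

end Acc

/-! ### Reductions -/

/-- `P` reduces to `P'` by random substitutions with one-sided error: no-instances are always
mapped to no-instances, and yes-instances are mapped to yes-instances with probability at
least `p`. -/
def Reduces {I I' : Type} (p : ℝ) (P : Problem I) (P' : Problem I') : Prop :=
  ∃ (Ω : Type) (_ : Fintype Ω) (g : Ω → I' → I ⊕ Bool), Nonempty Ω ∧ ∀ x ∈ P.dom,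
    (x ∉ P.yes → ∀ ω, pull (g ω) x ∈ P'.dom ∧ pull (g ω) x ∉ P'.yes) ∧
    (x ∈ P.yes → ∃ G : Finset Ω, p * Fintype.card Ω ≤ G.card ∧
      ∀ ω ∈ G, pull (g ω) x ∈ P'.dom ∧ pull (g ω) x ∈ P'.yes)

/-- The numbers of queries with which `P` can be solved. -/
def costs {I : Type} [Fintype I] [DecidableEq I] (P : Problem I) : Set ℕ :=
  {T : ℕ | ∃ A : QueryAlgorithm I, A.Solves P ∧ A.queries = T}

/-- With error at most `p / 4` on each substituted input, the averaged acceptance probability is at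
most `p / 4` on no-instances and at least `p / 2` on yes-instances. A second amplification restores
the error `1 / 3`. Both amplifications depend on `p` alone. -/
lemma Reduces.exists_costs {p : ℝ} (hp : 0 < p) (hp1 : p ≤ 1) :
    ∃ C : ℕ, ∀ (I I' : Type) [Fintype I] [DecidableEq I] [Nonempty I] [Fintype I']
      [DecidableEq I'] (P : Problem I) (P' : Problem I'), Reduces p P P' →
      ∀ T ∈ costs P', C * T ∈ costs P := by
  obtain ⟨C₁, h₁⟩ := exists_amplify (a := 1 / 3) (b := 2 / 3) (ε := p / 4) (by norm_num)
    (by norm_num) (by norm_num) (by linarith)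
  obtain ⟨C₂, h₂⟩ := exists_amplify (a := p / 4) (b := p / 2) (ε := 1 / 3) (by linarith)
    (by linarith) (by linarith) (by norm_num)
  refine ⟨C₂ * C₁, fun I I' _ _ _ _ _ P P' ⟨Ω, _, g, _, hg⟩ T ⟨A, hA, hAT⟩ => ?_⟩
  obtain ⟨q, hq, hqA⟩ := h₁ I' _ _ A.acc
  obtain ⟨r, hr, hrq⟩ := h₂ I _ _ (hq.average g)
  obtain ⟨B, hB, hBr⟩ := hr.exists_queryAlgorithm
  have hΩ : (0 : ℝ) < Fintype.card Ω := by exact_mod_cast Fintype.card_pos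
  refine ⟨B, fun x hx => ⟨fun hy => ?_, fun hn => ?_⟩, by rw [hB, hAT, mul_assoc]⟩
  · obtain ⟨G, hG, hGy⟩ := (hg x hx).2 hy
    rw [hBr]
    have : (1 : ℝ) - 1 / 3 ≤ r x := by
      refine (hrq x).2 ?_
      rw [le_div_iff₀ hΩ]
      calc p / 2 * Fintype.card Ω ≤ G.card * (1 / 2) := by linarith
        _ = ∑ ω ∈ G, (1 / 2 : ℝ) := by simp
        _ ≤ ∑ ω ∈ G, q (pull (g ω) x) := by
          refine Finset.sum_le_sum fun ω hω => ?_
          have := (hqA _).2 ((hA _ (hGy ω hω).1).1 (hGy ω hω).2)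
          linarith
        _ ≤ ∑ ω, q (pull (g ω) x) :=
          Finset.sum_le_univ_sum_of_nonneg fun ω => hq.nonneg _
    linarith
  · rw [hBr]
    refine (hrq x).1 ?_
    rw [div_le_iff₀ hΩ]
    calc ∑ ω, q (pull (g ω) x) ≤ ∑ ω : Ω, p / 4 := by
          refine Finset.sum_le_sum fun ω _ => ?_
          have := (hg x hx).1 hn ω
          exact (hqA _).1 ((hA _ this.1).2 this.2)
      _ = p / 4 * Fintype.card Ω := by simp [mul_comm]

lemma Reduces.of_subset {I : Type} {P P' : Problem I} (hdom : P.dom ⊆ P'.dom)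
    (hyes : P.yes = P'.yes) : Reduces 1 P P' := by
  refine ⟨Unit, inferInstance, fun _ i => Sum.inl i, ⟨()⟩, fun x hx => ⟨fun hn _ => ?_, fun hy =>
    ⟨Finset.univ, by simp, fun _ _ => ?_⟩⟩⟩
  · exact ⟨hdom hx, hyes ▸ hn⟩
  · exact ⟨hdom hx, hyes ▸ hy⟩

/-- The converse `h'` is needed because `sInf ∅ = 0`: it ensures that if `P'` had no algorithm,
neither would `P`. -/
lemma Q_le_of_costs {I I' : Type} [Fintype I] [DecidableEq I] [Fintype I'] [DecidableEq I']
    {P : Problem I} {P' : Problem I'} {C C' : ℕ} (h : ∀ T ∈ costs P', C * T ∈ costs P)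
    (h' : ∀ T ∈ costs P, C' * T ∈ costs P') : Q P ≤ C * Q P' := by
  change sInf (costs P) ≤ C * sInf (costs P')
  rcases (costs P').eq_empty_or_nonempty with h0 | h0
  · have : costs P = ∅ := by
      by_contra hne
      obtain ⟨T, hT⟩ := Set.nonempty_iff_ne_empty.2 hne
      exact (h0 ▸ h' T hT : C' * T ∈ (∅ : Set ℕ))
    simp [this]
  · exact Nat.sInf_le (h _ (Nat.sInf_mem h0))

end QueryComplexity

namespace QueryComplexity

/-! ### Paths and cycles as sequences of vertices -/

section Sequences

variable {n : ℕ}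

/-- The sequence `v 0, …, v l` is a directed walk. -/
def IsWalk (x : AdjMatrix n) (l : ℕ) (v : ℕ → Fin n) : Prop :=
  ∀ i < l, x (v i, v (i + 1)) = true

lemma mem_hasDirPath_iff {x : AdjMatrix n} {s t : Fin n} (hs : (s : ℕ) = 0) (ht : (t : ℕ) = 1)
    (l : ℕ) : x ∈ hasDirPath l n ↔
      ∃ v, IsWalk x l v ∧ v 0 = s ∧ v l = t ∧ Set.InjOn v (Set.Iic l) := by
  constructor
  · rintro ⟨φ, hφ, hv, hadj⟩
    have h0 := hv 0
    have h1 := hv 1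
    -- Walks are sequences on all of `ℕ`; the values beyond `l` are irrelevant.
    refine ⟨fun i => φ ⟨min i l, by omega⟩, fun i hi => hadj _ _ ?_, ?_, ?_, ?_⟩
    · simp only [dirPathGraph]
      omega
    · apply Fin.ext
      rw [hs]
      simpa using h0
    · apply Fin.ext
      rw [ht]
      simp only [min_self]
      simpa [Fin.last] using h1
    · intro i hi j hj hij
      have := congrArg Fin.val (hφ hij)
      simp only [Set.mem_Iic] at hi hj
      simp only at this
      omega
  · rintro ⟨v, hw, h0, h1, hv⟩
    refine ⟨fun i => v i, fun i j hij => ?_, fun j => ?_, fun a b hab => ?_⟩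
    · exact Fin.ext (hv (Nat.lt_succ_iff.1 i.2) (Nat.lt_succ_iff.1 j.2) hij)
    · fin_cases j
      · simp [h0, hs]
      · simp [h1, ht]
    · have hab' : (a : ℕ) + 1 = b := hab
      have := hw a (by omega)
      rwa [hab'] at this

lemma mem_hasDirCycle_iff {x : AdjMatrix n} {s : Fin n} (hs : (s : ℕ) = 0) {l : ℕ} (hl : 3 ≤ l) :
    x ∈ hasDirCycle l n ↔
      ∃ v, IsWalk x l v ∧ v 0 = s ∧ v l = s ∧ Set.InjOn v (Set.Iio l) := by
  have : NeZero l := ⟨by omega⟩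
  have : Fact (1 < l) := ⟨by omega⟩
  constructor
  · rintro ⟨φ, hφ, hv, hadj⟩
    have h0 := hv 0
    have h0' : φ 0 = s := Fin.ext (by rw [hs]; simpa using h0)
    refine ⟨fun i => φ (i : ZMod l), fun i hi => hadj _ _ ?_, ?_, ?_, ?_⟩
    · simp [dirCycleGraph]
    · simpa using h0'
    · simpa using h0'
    · intro i hi j hj hij
      have := (ZMod.natCast_eq_natCast_iff' _ _ _).1 (hφ hij)
      rwa [Nat.mod_eq_of_lt hi, Nat.mod_eq_of_lt hj] at this
  · rintro ⟨v, hw, h0, h1, hv⟩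
    refine ⟨fun z => v z.val, fun i j hij => ?_, fun j => ?_, fun a b hab => ?_⟩
    · exact ZMod.val_injective l (hv (ZMod.val_lt i) (ZMod.val_lt j) hij)
    · fin_cases j
      simp [h0, hs]
    · have hab' : a + 1 = b := hab
      have hlt := ZMod.val_lt a
      have hb : b.val = (a.val + 1) % l := by rw [← hab', ZMod.val_add, ZMod.val_one]
      have := hw a.val hlt
      change x (v a.val, v b.val) = true
      rcases Nat.lt_or_ge (a.val + 1) l with h | h
      · rwa [hb, Nat.mod_eq_of_lt h]
      · have hal : a.val + 1 = l := by omega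
        rw [hal, h1] at this
        rwa [hb, hal, Nat.mod_self, h0]

end Sequences

/-! ### Layered graphs -/

section Layered

variable {n : ℕ}

/-- All arcs lead from a layer to the next one, `s` is in layer `0` and `t` in layer `k`. -/
def Layered (s t : Fin n) (k : ℕ) (y : AdjMatrix n) : Prop :=
  ∃ lay : Fin n → ℕ, lay s = 0 ∧ lay t = k ∧ ∀ u w, y (u, w) = true → lay w = lay u + 1

lemma IsWalk.lay_eq {y : AdjMatrix n} {l : ℕ} {v : ℕ → Fin n} (hw : IsWalk y l v)
    {lay : Fin n → ℕ} (hlay : ∀ u w, y (u, w) = true → lay w = lay u + 1)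
    (h0 : lay (v 0) = 0) : ∀ i ≤ l, lay (v i) = i := by
  intro i hi
  induction i with
  | zero => exact h0
  | succ i ih => rw [hlay _ _ (hw i (by omega)), ih (by omega)]

/-- This makes the length conditions and the promises automatic on layered graphs. -/
lemma Layered.length_eq {s t : Fin n} {k l : ℕ} {y : AdjMatrix n} (hy : Layered s t k y)
    {v : ℕ → Fin n} (hw : IsWalk y l v) (h0 : v 0 = s) (hl : v l = t) : l = k := by
  obtain ⟨lay, hs, ht, hlay⟩ := hy
  rw [← ht, ← hl, hw.lay_eq hlay (by rw [h0, hs]) l le_rfl]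

lemma Layered.mem_simpleDigraphs {s t : Fin n} {k : ℕ} {y : AdjMatrix n}
    (hy : Layered s t k y) : y ∈ simpleDigraphs n := by
  obtain ⟨lay, -, -, hlay⟩ := hy
  intro v
  by_contra h
  have := hlay v v (by simpa using h)
  omega

/-- A problem that contains the problem of detecting an `s`-`t` path in a layered graph. -/
def DetectsLayered (k : ℕ) {n : ℕ} (s t : Fin n) (P : Problem (Fin n × Fin n)) : Prop :=
  ∃ τ : Fin n × Fin n → (Fin n × Fin n) ⊕ Bool, ∀ y, Layered s t k y →
    pull τ y ∈ P.dom ∧ (pull τ y ∈ P.yes ↔ y ∈ hasDirPath k n)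

variable {s t : Fin n} {k : ℕ}

lemma Layered.hasDirPath_length (hs : (s : ℕ) = 0) (ht : (t : ℕ) = 1) {y : AdjMatrix n}
    (hy : Layered s t k y) {l : ℕ} (h : y ∈ hasDirPath l n) : l = k := by
  obtain ⟨v, hw, h0, h1, -⟩ := (mem_hasDirPath_iff hs ht l).1 h
  exact hy.length_eq hw h0 h1

lemma detectsLayered_promDirPathEq (hs : (s : ℕ) = 0) (ht : (t : ℕ) = 1) :
    DetectsLayered k s t (PromDirPathEq k n) := by
  refine ⟨Sum.inl, fun y hy => ⟨⟨hy.mem_simpleDigraphs, ?_⟩, Iff.rfl⟩⟩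
  rintro ⟨l, -, h⟩
  exact hy.hasDirPath_length hs ht h ▸ h

lemma detectsLayered_promDirPathLe (hk : 3 ≤ k) (hs : (s : ℕ) = 0) (ht : (t : ℕ) = 1) :
    DetectsLayered k s t (PromDirPathLe k n) := by
  refine ⟨Sum.inl, fun y hy => ⟨⟨hy.mem_simpleDigraphs, ?_⟩, ?_, ?_⟩⟩
  · rintro ⟨l, h1, h⟩
    exact ⟨l, h1, (hy.hasDirPath_length hs ht h).le, h⟩
  · rintro ⟨l, -, -, h⟩
    exact hy.hasDirPath_length hs ht h ▸ h
  · intro h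
    exact ⟨k, by omega, le_rfl, h⟩

/-! ### Closing paths up into cycles -/

/-- Identify `t` with `s`. -/
def closeUp (s t : Fin n) (e : Fin n × Fin n) : (Fin n × Fin n) ⊕ Bool :=
  if e.2 = s then Sum.inl (e.1, t) else if e.2 = t then Sum.inr false else Sum.inl e

lemma pull_closeUp_eq_true {y : AdjMatrix n} {u w : Fin n} :
    pull (closeUp s t) y (u, w) = true ↔
      (w = s ∧ y (u, t) = true) ∨ (w ≠ s ∧ w ≠ t ∧ y (u, w) = true) := by
  by_cases h1 : w = s
  · simp [pull, closeUp, h1]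
  · by_cases h2 : w = t
    · subst h2
      simp [pull, closeUp, h1]
    · simp [pull, closeUp, h1, h2]

/-- A loop at `s` could only come from an arc `(s, t)`, which would force `k = 1`. -/
lemma Layered.closeUp_mem_simpleDigraphs (hk : 3 ≤ k) {y : AdjMatrix n} (hy : Layered s t k y) :
    pull (closeUp s t) y ∈ simpleDigraphs n := by
  obtain ⟨lay, hs, ht, hlay⟩ := hy
  intro v
  by_contra h
  rw [Bool.not_eq_false, pull_closeUp_eq_true] at h
  rcases h with ⟨rfl, h⟩ | ⟨-, -, h⟩
  · have := hlay _ _ h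
    omega
  · have := hlay _ _ h
    omega

/-- The cycle avoids `t`, which has lost its incoming arcs, and enters `s` only at its last step.
That step stems from an arc into `t`, so replacing the final `s` by `t` gives the path. -/
lemma Layered.closeUp_hasDirCycle (hs : (s : ℕ) = 0) (ht : (t : ℕ) = 1) {l : ℕ} (hl : 3 ≤ l)
    {y : AdjMatrix n} (h : pull (closeUp s t) y ∈ hasDirCycle l n) : y ∈ hasDirPath l n := by
  have hst : s ≠ t := fun h => by rw [h] at hs; omega
  obtain ⟨v, hw, h0, h1, hv⟩ := (mem_hasDirCycle_iff hs hl).1 h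
  have hne : ∀ i < l, v i ≠ t := by
    intro i hi
    rcases i with _ | i
    · rwa [h0]
    · have := pull_closeUp_eq_true.1 (hw i (by omega))
      rcases this with h | h
      · rw [← h0] at h
        have := hv (show i + 1 < l from hi) (show 0 < l by omega) h.1
        omega
      · exact h.2.1
  refine (mem_hasDirPath_iff hs ht l).2 ⟨Function.update v l t, fun i hi => ?_, ?_, ?_, ?_⟩
  · rw [Function.update_of_ne hi.ne]
    rcases pull_closeUp_eq_true.1 (hw i hi) with h | h
    · have : i + 1 = l := by
        by_contra hil
        rw [← h0] at h
        have := hv (show i + 1 < l by omega) (show 0 < l by omega) h.1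
        omega
      rw [this, Function.update_self]
      exact h.2
    · have : i + 1 ≠ l := by
        intro hil
        rw [hil, h1] at h
        exact h.1 rfl
      rw [Function.update_of_ne this]
      exact h.2.2
  · rw [Function.update_of_ne (by omega), h0]
  · rw [Function.update_self]
  · intro i hi j hj hij
    simp only [Set.mem_Iic] at hi hj
    rcases hi.eq_or_lt with rfl | hi <;> rcases hj.eq_or_lt with rfl | hj
    · rfl
    · rw [Function.update_self, Function.update_of_ne hj.ne] at hij
      exact (hne j hj hij.symm).elim
    · rw [Function.update_self, Function.update_of_ne hi.ne] at hij
      exact (hne i hi hij).elim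
    · rw [Function.update_of_ne hi.ne, Function.update_of_ne hj.ne] at hij
      exact hv hi hj hij

lemma closeUp_hasDirCycle_of_hasDirPath (hs : (s : ℕ) = 0) (ht : (t : ℕ) = 1) {l : ℕ}
    (hl : 3 ≤ l) {y : AdjMatrix n} (h : y ∈ hasDirPath l n) :
    pull (closeUp s t) y ∈ hasDirCycle l n := by
  obtain ⟨v, hw, h0, h1, hv⟩ := (mem_hasDirPath_iff hs ht l).1 h
  refine (mem_hasDirCycle_iff hs hl).2 ⟨Function.update v l s, fun i hi => ?_, ?_, ?_, ?_⟩
  · rw [Function.update_of_ne hi.ne, pull_closeUp_eq_true]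
    have hy := hw i hi
    rcases eq_or_ne (i + 1) l with hil | hil
    · rw [hil, h1] at hy
      rw [hil, Function.update_self]
      exact Or.inl ⟨rfl, hy⟩
    · rw [Function.update_of_ne hil]
      refine Or.inr ⟨fun h => ?_, fun h => ?_, hy⟩
      · rw [← h0] at h
        have := hv (show i + 1 ≤ l by omega) (show 0 ≤ l by omega) h
        omega
      · rw [← h1] at h
        exact hil (hv (show i + 1 ≤ l by omega) (show l ≤ l from le_rfl) h)
  · rw [Function.update_of_ne (by omega), h0]
  · rw [Function.update_self]
  · intro i hi j hj hij
    simp only [Set.mem_Iio] at hi hj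
    rw [Function.update_of_ne hi.ne, Function.update_of_ne hj.ne] at hij
    exact hv hi.le hj.le hij

lemma detectsLayered_promDirCycleEq (hk : 3 ≤ k) (hs : (s : ℕ) = 0) (ht : (t : ℕ) = 1) :
    DetectsLayered k s t (PromDirCycleEq k n) := by
  refine ⟨closeUp s t, fun y hy => ⟨⟨hy.closeUp_mem_simpleDigraphs hk, ?_⟩,
    Layered.closeUp_hasDirCycle hs ht hk, closeUp_hasDirCycle_of_hasDirPath hs ht hk⟩⟩
  rintro ⟨l, hl, h⟩
  exact hy.hasDirPath_length hs ht (Layered.closeUp_hasDirCycle hs ht hl h) ▸ h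

lemma detectsLayered_promDirCycleLe (hk : 3 ≤ k) (hs : (s : ℕ) = 0) (ht : (t : ℕ) = 1) :
    DetectsLayered k s t (PromDirCycleLe k n) := by
  refine ⟨closeUp s t, fun y hy => ⟨⟨hy.closeUp_mem_simpleDigraphs hk, ?_⟩, ?_, fun h =>
    ⟨k, hk, le_rfl, closeUp_hasDirCycle_of_hasDirPath hs ht hk h⟩⟩⟩
  · rintro ⟨l, hl, h⟩
    exact ⟨l, hl, (hy.hasDirPath_length hs ht (Layered.closeUp_hasDirCycle hs ht hl h)).le, h⟩
  · rintro ⟨l, hl, -, h⟩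
    have h' := Layered.closeUp_hasDirCycle hs ht hl h
    exact hy.hasDirPath_length hs ht h' ▸ h'

/-! ### Random layers -/

/-- There is a walk `v 0, …, v l` in which `v i = a` if `ρ i = some a`, and in which the vertices
`v i` with `ρ i = none` are distinct and different from `s` and `t`. -/
def HasWalk (s t : Fin n) (l : ℕ) (ρ : ℕ → Option (Fin n)) (x : AdjMatrix n) : Prop :=
  ∃ v, IsWalk x l v ∧ (∀ i ≤ l, ∀ a, ρ i = some a → v i = a) ∧
    (∀ i ≤ l, ρ i = none → v i ≠ s ∧ v i ≠ t) ∧ Set.InjOn v {i | i ≤ l ∧ ρ i = none}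

/-- The layers given by the colouring `c`, with `s` moved to the first and `t` to the last. -/
def layerOf (s t : Fin n) (c : Fin n → Fin (k + 1)) (u : Fin n) : ℕ :=
  if u = s then 0 else if u = t then k else c u

/-- The layered graph in which the vertices in layer `i` are copies of `a` if `ρ i = some a`, and
in which all arcs between consecutive layers are present from layer `l` on. -/
def layerSubst (l : ℕ) (ρ : ℕ → Option (Fin n)) (lay : Fin n → ℕ) (e : Fin n × Fin n) :
    (Fin n × Fin n) ⊕ Bool :=
  if lay e.2 = lay e.1 + 1 then
    if lay e.1 < l then Sum.inl ((ρ (lay e.1)).getD e.1, (ρ (lay e.2)).getD e.2)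
    else Sum.inr true
  else Sum.inr false

lemma pull_layerSubst_eq_true {x : AdjMatrix n} {l : ℕ} {ρ : ℕ → Option (Fin n)}
    {lay : Fin n → ℕ} {u w : Fin n} :
    pull (layerSubst l ρ lay) x (u, w) = true ↔ lay w = lay u + 1 ∧
      (lay u < l → x ((ρ (lay u)).getD u, (ρ (lay w)).getD w) = true) := by
  by_cases h1 : lay w = lay u + 1
  · by_cases h2 : lay u < l <;> simp [pull, layerSubst, h1, h2]
  · simp [pull, layerSubst, h1]

lemma layered_pull_layerSubst (hst : s ≠ t) {x : AdjMatrix n} {l : ℕ} {ρ : ℕ → Option (Fin n)}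
    (c : Fin n → Fin (k + 1)) : Layered s t k (pull (layerSubst l ρ (layerOf s t c)) x) :=
  ⟨layerOf s t c, by simp [layerOf], by simp [layerOf, hst.symm],
    fun _ _ h => (pull_layerSubst_eq_true.1 h).1⟩

/-- Soundness: the `i`-th vertex of the path lies in layer `i`, so reading copies as their originals
gives the walk. Positions `0` and `l` are marked, hence free vertices lie strictly between layers
`0` and `k`, where `s` and `t` do not occur. -/
lemma hasWalk_of_pull_layerSubst (hs : (s : ℕ) = 0) (ht : (t : ℕ) = 1) {x : AdjMatrix n} {l : ℕ}
    (hlk : l ≤ k) {ρ : ℕ → Option (Fin n)} (h0 : ρ 0 ≠ none) (hl : ρ l ≠ none)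
    {c : Fin n → Fin (k + 1)}
    (h : pull (layerSubst l ρ (layerOf s t c)) x ∈ hasDirPath k n) : HasWalk s t l ρ x := by
  have hst : s ≠ t := fun h => by rw [h] at hs; omega
  obtain ⟨u, hw, hu0, huk, hu⟩ := (mem_hasDirPath_iff hs ht k).1 h
  have hlay : ∀ i ≤ k, layerOf s t c (u i) = i :=
    hw.lay_eq (fun _ _ h => (pull_layerSubst_eq_true.1 h).1) (by simp [layerOf, hu0])
  have hne : ∀ i ≤ l, ρ i = none → i ≠ 0 ∧ i ≠ k := by
    intro i hi hρ
    refine ⟨fun h => h0 (h ▸ hρ), fun h => ?_⟩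
    have : i = l := by omega
    exact hl (this ▸ hρ)
  refine ⟨fun i => (ρ i).getD (u i), fun i hi => ?_, fun i _ a ha => by simp [ha],
    fun i hi hρ => ?_, fun i hi j hj hij => ?_⟩
  · have := (pull_layerSubst_eq_true.1 (hw i (by omega))).2
    rw [hlay i (by omega), hlay (i + 1) (by omega)] at this
    exact this hi
  · have hi' := hlay i (by omega)
    simp only [hρ, Option.getD_none]
    refine ⟨fun h => (hne i hi hρ).1 ?_, fun h => (hne i hi hρ).2 ?_⟩
    · rw [← hi', h]
      simp [layerOf]
    · rw [← hi', h]
      simp [layerOf, hst.symm]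
  · simp only [hi.2, hj.2, Option.getD_none] at hij
    exact hu (hi.1.trans hlk) (hj.1.trans hlk) hij

/-- The number of colourings that are prescribed on `m` vertices. -/
lemma card_colourings {K m : ℕ} (u : Fin m → Fin n) (hu : Function.Injective u)
    (d : Fin m → Fin K) :
    Finset.card {c : Fin n → Fin K | ∀ i, c (u i) = d i} * K ^ m = K ^ n := by
  classical
  have h : (Finset.univ.filter fun c : Fin n → Fin K => ∀ i, c (u i) = d i) =
      Fintype.piFinset fun w => Finset.univ.filter fun b => ∀ i, u i = w → b = d i := by
    ext c
    simp only [Finset.mem_filter, Finset.mem_univ, true_and, Fintype.mem_piFinset]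
    exact ⟨fun h w i hi => hi ▸ h i, fun h i => h _ i rfl⟩
  have hcard : ∀ w, Finset.card (Finset.univ.filter fun b : Fin K => ∀ i, u i = w → b = d i) =
      if w ∈ Finset.univ.image u then 1 else K := by
    intro w
    split_ifs with hw
    · obtain ⟨i, -, rfl⟩ := Finset.mem_image.1 hw
      rw [Finset.card_eq_one]
      refine ⟨d i, ?_⟩
      ext b
      simp only [Finset.mem_filter, Finset.mem_univ, true_and, Finset.mem_singleton]
      exact ⟨fun h => h i rfl, fun h j hj => by rw [h, hu hj]⟩
    · rw [Finset.filter_true_of_mem, Finset.card_univ, Fintype.card_fin]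
      intro b _ i hi
      exact (hw (Finset.mem_image.2 ⟨i, Finset.mem_univ _, hi⟩)).elim
  have hm : (Finset.univ.image u).card = m := by
    rw [Finset.card_image_of_injective _ hu, Finset.card_univ, Fintype.card_fin]
  have hmn : m ≤ n := by
    simpa using Fintype.card_le_of_injective u hu
  rw [h, Fintype.card_piFinset, Finset.prod_congr rfl fun w _ => hcard w, Finset.prod_ite]
  have : (Finset.univ.filter fun w => w ∉ Finset.univ.image u).card = n - m := by
    rw [← Finset.compl_filter, Finset.card_compl, Finset.filter_mem_eq_inter, Finset.univ_inter, hm,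
      Fintype.card_fin]
  rw [Finset.prod_const_one, one_mul, Finset.prod_const, this, ← pow_add, Nat.sub_add_cancel hmn]

/-- Any vertex can act as a copy in a marked layer, or as padding beyond `l`. So a walk that repeats
`s`, or meets `t` early, still lifts to a sequence of distinct vertices from `s` to `t`. -/
lemma exists_representatives (hst : s ≠ t) (hn : 2 * k + 5 ≤ n) (hk : 1 ≤ k) {l : ℕ} (hlk : l ≤ k)
    {ρ : ℕ → Option (Fin n)} (h0 : ρ 0 ≠ none) (hl : ρ l ≠ none) (v : ℕ → Fin n)
    (hne : ∀ i ≤ l, ρ i = none → v i ≠ s ∧ v i ≠ t)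
    (hv : Set.InjOn v {i | i ≤ l ∧ ρ i = none}) :
    ∃ u : ℕ → Fin n, u 0 = s ∧ u k = t ∧ Set.InjOn u (Set.Iic k) ∧
      ∀ i ≤ l, ρ i = none → u i = v i := by
  classical
  let B : Finset (Fin n) := {s, t} ∪ (Finset.range (k + 1)).image v
  have hB : B.card ≤ k + 3 := by
    refine (Finset.card_union_le _ _).trans ?_
    have h1 : Finset.card {s, t} ≤ 2 := Finset.card_le_two
    have h2 : ((Finset.range (k + 1)).image v).card ≤ k + 1 :=
      Finset.card_image_le.trans (by simp)
    omega
  -- Besides the at most `k + 3` vertices of `B`, there is room for `k + 1` fresh ones.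
  obtain ⟨f⟩ : Nonempty (Fin (k + 1) ↪ (Bᶜ : Finset (Fin n))) := by
    rw [Function.Embedding.nonempty_iff_card_le, Fintype.card_coe, Finset.card_compl,
      Fintype.card_fin, Fintype.card_fin]
    omega
  let w : ℕ → Fin n := fun i => f ⟨min i k, by omega⟩
  have hwB : ∀ i, w i ≠ s ∧ w i ≠ t ∧ ∀ j ≤ k, w i ≠ v j := by
    intro i
    have := (f ⟨min i k, by omega⟩).2
    simp only [B, Finset.mem_compl, Finset.mem_union, Finset.mem_insert, Finset.mem_singleton,
      Finset.mem_image, Finset.mem_range, not_or, not_exists, not_and] at this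
    exact ⟨this.1.1, this.1.2, fun j hj h => this.2 j (by omega) h.symm⟩
  have hw : Set.InjOn w (Set.Iic k) := by
    intro i hi j hj hij
    have := congrArg Fin.val (f.injective (Subtype.ext hij))
    simp only [Set.mem_Iic] at hi hj
    simp only at this
    omega
  have hρ : ∀ i ≤ l, ρ i = none → i ≠ 0 ∧ i ≠ k := by
    intro i hi hρ
    refine ⟨fun h => h0 (h ▸ hρ), fun h => ?_⟩
    have : i = l := by omega
    exact hl (this ▸ hρ)
  refine ⟨fun i => if i = 0 then s else if i = k then t else if i ≤ l ∧ ρ i = none then v i else w i,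
    by simp, by simp; omega, ?_, fun i hi h => ?_⟩
  · intro i hi j hj hij
    simp only [Set.mem_Iic] at hi hj
    have hwi := hwB i
    have hwj := hwB j
    simp only at hij
    split_ifs at hij with h1 h2 h3 h4 h5 h6 h7 h8 h9 h10 h11 h12 h13 h14 h15
    all_goals first
      | omega
      | exact absurd hij hst
      | exact absurd hij hst.symm
      | exact absurd hij (hne _ (by tauto) (by tauto)).1
      | exact absurd hij (hne _ (by tauto) (by tauto)).2
      | exact absurd hij.symm (hne _ (by tauto) (by tauto)).1
      | exact absurd hij.symm (hne _ (by tauto) (by tauto)).2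
      | exact absurd hij hwi.1
      | exact absurd hij hwi.2.1
      | exact absurd hij.symm hwj.1
      | exact absurd hij.symm hwj.2.1
      | exact absurd hij (hwi.2.2 j hj)
      | exact absurd hij.symm (hwj.2.2 i hi)
      | exact hv (by assumption) (by assumption) hij
      | exact hw hi hj hij
  · simp [(hρ i hi h).1, (hρ i hi h).2, hi, h]

lemma HasWalk.exists_colourings (hs : (s : ℕ) = 0) (ht : (t : ℕ) = 1) (hn : 2 * k + 5 ≤ n)
    (hk : 1 ≤ k) {l : ℕ} (hlk : l ≤ k) {ρ : ℕ → Option (Fin n)} (h0 : ρ 0 ≠ none)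
    (hl : ρ l ≠ none) {x : AdjMatrix n} (h : HasWalk s t l ρ x) :
    ∃ G : Finset (Fin n → Fin (k + 1)), G.card * (k + 1) ^ (k + 1) = (k + 1) ^ n ∧
      ∀ c ∈ G, pull (layerSubst l ρ (layerOf s t c)) x ∈ hasDirPath k n := by
  have hst : s ≠ t := fun h => by rw [h] at hs; omega
  obtain ⟨v, hw, hva, hne, hv⟩ := h
  obtain ⟨u, hu0, huk, hu, huv⟩ := exists_representatives hst hn hk hlk h0 hl v hne hv
  -- The good colourings give each representative `u i` the colour `i`.
  refine ⟨_, card_colourings (fun i : Fin (k + 1) => u i) (fun i j hij => Fin.ext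
    (hu (Nat.lt_succ_iff.1 i.2) (Nat.lt_succ_iff.1 j.2) hij)) id, fun c hc => ?_⟩
  simp only [id_eq, Finset.mem_filter, Finset.mem_univ, true_and] at hc
  have hlay : ∀ i ≤ k, layerOf s t c (u i) = i := by
    intro i hi
    have := congrArg Fin.val (hc ⟨i, by omega⟩)
    simp only at this
    rw [layerOf, this]
    split_ifs with h1 h2
    · exact hu (show 0 ≤ k by omega) hi (by rw [hu0, h1])
    · exact hu (show k ≤ k from le_rfl) hi (by rw [huk, h2])
    · rfl
  have hrole : ∀ i ≤ l, (ρ i).getD (u i) = v i := by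
    intro i hi
    cases hρ : ρ i with
    | none => simpa using huv i hi hρ
    | some a => simpa using (hva i hi a hρ).symm
  refine (mem_hasDirPath_iff hs ht k).2 ⟨u, fun i hi => ?_, hu0, huk, hu⟩
  rw [pull_layerSubst_eq_true, hlay i (by omega), hlay (i + 1) (by omega)]
  refine ⟨rfl, fun hil => ?_⟩
  rw [hrole i (by omega), hrole (i + 1) (by omega)]
  exact hw i hil

end Layered

end QueryComplexity

namespace QueryComplexity

/-! ### Reductions between path and cycle problems -/

section Main

variable {n k : ℕ} {s t : Fin n}

/-- The yes-instances of `P` are the graphs that contain one of at most `K` kinds of walks. -/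
def DetectsWalks (K k : ℕ) (s t : Fin n) (P : Problem (Fin n × Fin n)) : Prop :=
  ∃ (ι : Type) (_ : Fintype ι) (l : ι → ℕ) (ρ : ι → ℕ → Option (Fin n)), Nonempty ι ∧
    Fintype.card ι ≤ K ∧ (∀ i, l i ≤ k ∧ ρ i 0 ≠ none ∧ ρ i (l i) ≠ none) ∧
    ∀ x, x ∈ P.yes ↔ ∃ i, HasWalk s t (l i) (ρ i) x

lemma pull_pull {I I' I'' : Type} (τ : I'' → I' ⊕ Bool) (g : I' → I ⊕ Bool) (x : I → Bool) :
    pull τ (pull g x) = pull (fun i => Sum.elim g Sum.inr (τ i)) x := by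
  ext i
  simp only [pull]
  cases τ i <;> simp [pull]

/-- The random choice is a kind of walk together with a colouring: the right kind is hit with
probability at least `1 / K`, and then a good colouring with probability `(k + 1)^(-(k + 1))`. -/
lemma DetectsWalks.reduces {K : ℕ} (hs : (s : ℕ) = 0) (ht : (t : ℕ) = 1) (hn : 2 * k + 5 ≤ n)
    (hk : 1 ≤ k) {P P' : Problem (Fin n × Fin n)} (hP : DetectsWalks K k s t P)
    (hP' : DetectsLayered k s t P') : Reduces (1 / (K * (k + 1) ^ (k + 1) : ℝ)) P P' := by
  have hst : s ≠ t := fun h => by rw [h] at hs; omega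
  obtain ⟨ι, _, l, ρ, _, hcard, hρ, hyes⟩ := hP
  obtain ⟨τ, hτ⟩ := hP'
  refine ⟨ι × (Fin n → Fin (k + 1)), inferInstance, fun ω i => Sum.elim
    (layerSubst (l ω.1) (ρ ω.1) (layerOf s t ω.2)) Sum.inr (τ i), inferInstance, fun x _ =>
    ⟨fun hx ω => ?_, fun hx => ?_⟩⟩
  · rw [← pull_pull]
    have := hτ _ (layered_pull_layerSubst hst (x := x) (l := l ω.1) (ρ := ρ ω.1) ω.2)
    refine ⟨this.1, fun h => hx ((hyes x).2 ⟨ω.1, ?_⟩)⟩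
    exact hasWalk_of_pull_layerSubst hs ht (hρ ω.1).1 (hρ ω.1).2.1 (hρ ω.1).2.2 (this.2.1 h)
  · obtain ⟨i, hi⟩ := (hyes x).1 hx
    obtain ⟨G, hG, hGx⟩ := hi.exists_colourings hs ht hn hk (hρ i).1 (hρ i).2.1 (hρ i).2.2
    refine ⟨{i} ×ˢ G, ?_, fun ω hω => ?_⟩
    · have hcard' : (Fintype.card ι : ℝ) ≤ K := by exact_mod_cast hcard
      have hι : (0 : ℝ) < Fintype.card ι := by exact_mod_cast Fintype.card_pos
      have hG' : (G.card : ℝ) * (k + 1) ^ (k + 1) = (k + 1) ^ n := by exact_mod_cast hG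
      rw [Finset.card_product, Finset.card_singleton, one_mul, div_mul_eq_mul_div, one_mul,
        div_le_iff₀ (mul_pos (hι.trans_le hcard') (by positivity))]
      simp only [Fintype.card_prod, Fintype.card_pi, Fintype.card_fin, Finset.prod_const,
        Finset.card_univ]
      push_cast
      rw [← hG']
      have := mul_le_mul_of_nonneg_right hcard'
        (show (0 : ℝ) ≤ G.card * (k + 1) ^ (k + 1) by positivity)
      linarith
    · obtain ⟨j, c⟩ := ω
      obtain ⟨rfl, hc⟩ : j = i ∧ c ∈ G := by
        simpa [and_comm, eq_comm] using hω
      rw [← pull_pull]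
      have := hτ _ (layered_pull_layerSubst hst (x := x) (l := l j) (ρ := ρ j) c)
      exact ⟨this.1, this.2.2 (hGx c hc)⟩

/-! ### Paths and cycles as walks with marked positions -/

/-- The positions of `s` and `t` on an `s`-`t` path of length `l`. -/
def pathMarks (s t : Fin n) (l i : ℕ) : Option (Fin n) :=
  if i = 0 then some s else if i = l then some t else none

lemma hasWalk_pathMarks_iff (hs : (s : ℕ) = 0) (ht : (t : ℕ) = 1) {l : ℕ} (hl : 1 ≤ l)
    {x : AdjMatrix n} : HasWalk s t l (pathMarks s t l) x ↔ x ∈ hasDirPath l n := by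
  have hst : s ≠ t := fun h => by rw [h] at hs; omega
  have hnone : ∀ i, pathMarks s t l i = none ↔ i ≠ 0 ∧ i ≠ l := by
    intro i
    unfold pathMarks
    split_ifs <;> simp <;> omega
  rw [mem_hasDirPath_iff hs ht]
  constructor
  · rintro ⟨v, hw, hva, hne, hv⟩
    have h0 : v 0 = s := hva 0 (by omega) s (by simp [pathMarks])
    have h1 : v l = t := hva l le_rfl t (by simp [pathMarks]; omega)
    refine ⟨v, hw, h0, h1, fun i hi j hj hij => ?_⟩
    simp only [Set.mem_Iic] at hi hj
    by_cases hi' : i ≠ 0 ∧ i ≠ l <;> by_cases hj' : j ≠ 0 ∧ j ≠ l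
    · exact hv ⟨hi, (hnone i).2 hi'⟩ ⟨hj, (hnone j).2 hj'⟩ hij
    · have := hne i hi ((hnone i).2 hi')
      have hj'' : j = 0 ∨ j = l := by omega
      rcases hj'' with rfl | rfl
      · exact (this.1 (hij.trans h0)).elim
      · exact (this.2 (hij.trans h1)).elim
    · have := hne j hj ((hnone j).2 hj')
      have hi'' : i = 0 ∨ i = l := by omega
      rcases hi'' with rfl | rfl
      · exact (this.1 (hij.symm.trans h0)).elim
      · exact (this.2 (hij.symm.trans h1)).elim
    · have hi'' : i = 0 ∨ i = l := by omega
      have hj'' : j = 0 ∨ j = l := by omega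
      rcases hi'' with rfl | rfl <;> rcases hj'' with rfl | rfl
      · rfl
      · exact (hst (h0.symm.trans (hij.trans h1))).elim
      · exact (hst (h0.symm.trans (hij.symm.trans h1))).elim
      · rfl
  · rintro ⟨v, hw, h0, h1, hv⟩
    refine ⟨v, hw, fun i hi a ha => ?_, fun i hi h => ?_, hv.mono fun i hi => hi.1⟩
    · simp only [pathMarks] at ha
      split_ifs at ha with hi0 hil
      · rw [hi0, h0]
        exact Option.some.inj ha
      · rw [hil, h1]
        exact Option.some.inj ha
    · have := (hnone i).1 h
      refine ⟨fun h => this.1 (hv hi (show 0 ≤ l by omega) (h.trans h0.symm)), fun h =>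
        this.2 (hv hi (show l ≤ l from le_rfl) (h.trans h1.symm))⟩

/-- The positions of `s` and `t` on a cycle of length `l` through `s`, where `j = 0` stands for
cycles that do not pass through `t`. -/
def cycleMarks (s t : Fin n) (l j i : ℕ) : Option (Fin n) :=
  if i = 0 ∨ i = l then some s else if i = j then some t else none

/-- Free vertices must avoid `t`, so the position `j` of `t` on the cycle has to be guessed. The
values `j ≥ l`, like `j = 0`, mark no `t`, because the test for `s` comes first. -/
lemma exists_hasWalk_cycleMarks_iff (hs : (s : ℕ) = 0) (ht : (t : ℕ) = 1) {l : ℕ} (hl : 3 ≤ l)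
    (hlk : l ≤ k) {x : AdjMatrix n} :
    (∃ j : Fin k, HasWalk s t l (cycleMarks s t l j) x) ↔ x ∈ hasDirCycle l n := by
  have hst : s ≠ t := fun h => by rw [h] at hs; omega
  have hnone : ∀ j i, cycleMarks s t l j i = none ↔ (i ≠ 0 ∧ i ≠ l) ∧ i ≠ j := by
    intro j i
    by_cases h1 : i = 0 ∨ i = l
    · simp only [cycleMarks, h1, if_true]
      simp
      omega
    · by_cases h2 : i = j
      · simp only [cycleMarks, h1, if_false]
        simp [h2]
      · simp only [cycleMarks, h1, h2, if_false]
        simp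
        omega
  rw [mem_hasDirCycle_iff hs hl]
  constructor
  · rintro ⟨j, v, hw, hva, hne, hv⟩
    have h0 : v 0 = s := hva 0 (by omega) s (by simp [cycleMarks])
    have h1 : v l = s := hva l le_rfl s (by simp [cycleMarks])
    have hj : ∀ i < l, i ≠ 0 → i = j → v i = t := by
      intro i hi hi0 hij
      exact hva i hi.le t (by simp only [cycleMarks]; rw [if_neg (by omega), if_pos hij])
    refine ⟨v, hw, h0, h1, ?_⟩
    have hpos : ∀ i < l, i ≠ 0 → v i ≠ s := by
      intro i hi hi0
      by_cases hij : i = j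
      · rw [hj i hi hi0 hij]
        exact hst.symm
      · exact (hne i hi.le ((hnone j i).2 ⟨⟨hi0, hi.ne⟩, hij⟩)).1
    intro a ha b hb hab
    simp only [Set.mem_Iio] at ha hb
    by_cases ha0 : a = 0 <;> by_cases hb0 : b = 0
    · omega
    · rw [ha0, h0] at hab
      exact (hpos b hb hb0 hab.symm).elim
    · rw [hb0, h0] at hab
      exact (hpos a ha ha0 hab).elim
    · by_cases haj : a = j <;> by_cases hbj : b = j
      · omega
      · rw [hj a ha ha0 haj] at hab
        exact ((hne b hb.le ((hnone j b).2 ⟨⟨hb0, hb.ne⟩, hbj⟩)).2 hab.symm).elim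
      · rw [hj b hb hb0 hbj] at hab
        exact ((hne a ha.le ((hnone j a).2 ⟨⟨ha0, ha.ne⟩, haj⟩)).2 hab).elim
      · exact hv ⟨ha.le, (hnone j a).2 ⟨⟨ha0, ha.ne⟩, haj⟩⟩
          ⟨hb.le, (hnone j b).2 ⟨⟨hb0, hb.ne⟩, hbj⟩⟩ hab
  · rintro ⟨v, hw, h0, h1, hv⟩
    obtain ⟨j, hjl, hj⟩ : ∃ j < l, ∀ i < l, i ≠ 0 → (v i = t ↔ i = j) := by
      by_cases h : ∃ j < l, v j = t
      · obtain ⟨j, hj, hjt⟩ := h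
        exact ⟨j, hj, fun i hi _ => ⟨fun h => hv hi hj (h.trans hjt.symm), fun h => h ▸ hjt⟩⟩
      · push Not at h
        exact ⟨0, by omega, fun i hi hi0 => ⟨fun h' => (h i hi h').elim, fun h' => (hi0 h').elim⟩⟩
    refine ⟨⟨j, by omega⟩, v, hw, fun i hi a ha => ?_, fun i hi h => ?_, ?_⟩
    · simp only [cycleMarks] at ha
      split_ifs at ha with hi0 hij
      · rcases hi0 with rfl | rfl
        · exact h0.trans (Option.some.inj ha)
        · exact h1.trans (Option.some.inj ha)
      · exact ((hj i (by omega) (by omega)).2 hij).trans (Option.some.inj ha)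
    · have h' := (hnone j i).1 h
      have hil : i < l := by omega
      exact ⟨fun h => h'.1.1 (hv hil (show 0 < l by omega) (h.trans h0.symm)), fun h =>
        h'.2 ((hj i hil h'.1.1).1 h)⟩
    · exact hv.mono fun i hi => lt_of_le_of_ne hi.1 ((hnone j i).1 hi.2).1.2

lemma detectsWalks_of_paths (hs : (s : ℕ) = 0) (ht : (t : ℕ) = 1) {P : Problem (Fin n × Fin n)}
    (L : Finset ℕ) (hL : L.Nonempty) (hLk : ∀ l ∈ L, 1 ≤ l ∧ l ≤ k)
    (h : ∀ x, x ∈ P.yes ↔ ∃ l ∈ L, x ∈ hasDirPath l n) : DetectsWalks (k * k) k s t P := by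
  have hcard : L.card ≤ k := by
    have := Finset.card_le_card (show L ⊆ Finset.Icc 1 k from fun l hl =>
      Finset.mem_Icc.2 (hLk l hl))
    simpa using this
  refine ⟨L, inferInstance, fun l => l, fun l => pathMarks s t l, hL.to_subtype, ?_, fun l =>
    ⟨(hLk l l.2).2, by simp [pathMarks], ?_⟩, fun x => ?_⟩
  · rw [Fintype.card_coe]
    -- There are only `L.card ≤ k` kinds; the bound `k * k` is what cycles need, where the position
    -- of `t` is guessed too.
    nlinarith
  · by_cases h : (l : ℕ) = 0 <;> simp [pathMarks, h]
  · rw [h]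
    simp only [Subtype.exists, exists_prop]
    exact exists_congr fun l => and_congr_right fun hl =>
      (hasWalk_pathMarks_iff hs ht (hLk l hl).1).symm

lemma detectsWalks_of_cycles (hs : (s : ℕ) = 0) (ht : (t : ℕ) = 1) {P : Problem (Fin n × Fin n)}
    (L : Finset ℕ) (hL : L.Nonempty) (hLk : ∀ l ∈ L, 3 ≤ l ∧ l ≤ k)
    (h : ∀ x, x ∈ P.yes ↔ ∃ l ∈ L, x ∈ hasDirCycle l n) : DetectsWalks (k * k) k s t P := by
  have hcard : L.card ≤ k := by
    have := Finset.card_le_card (show L ⊆ Finset.Icc 1 k from fun l hl =>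
      Finset.mem_Icc.2 ⟨by linarith [hLk l hl], (hLk l hl).2⟩)
    simpa using this
  have hLne := hL.to_subtype
  obtain ⟨l₀, hl₀⟩ := hL
  have hk : Nonempty (Fin k) := ⟨⟨0, by have := hLk l₀ hl₀; omega⟩⟩
  refine ⟨L × Fin k, inferInstance, fun i => i.1, fun i => cycleMarks s t i.1 i.2, inferInstance,
    ?_, fun i => ⟨(hLk i.1 i.1.2).2, by simp [cycleMarks], by simp [cycleMarks]⟩, fun x => ?_⟩
  · rw [Fintype.card_prod, Fintype.card_coe, Fintype.card_fin]
    gcongr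
  · rw [h]
    simp only [Prod.exists, Subtype.exists]
    exact exists_congr fun l => ⟨fun ⟨hl, hx⟩ =>
        ⟨hl, (exists_hasWalk_cycleMarks_iff hs ht (hLk l hl).1 (hLk l hl).2).2 hx⟩,
      fun ⟨hl, hx⟩ =>
        ⟨hl, (exists_hasWalk_cycleMarks_iff hs ht (hLk l hl).1 (hLk l hl).2).1 hx⟩⟩

end Main

/-! ### Asymptotic comparison of the eight problems -/

/-- Up to a constant factor, `P` can be solved with as few queries as `P'`. -/
def Easier (P P' : (n : ℕ) → Problem (Fin n × Fin n)) : Prop :=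
  ∃ C : ℕ, ∀ᶠ n in Filter.atTop, ∀ T ∈ costs (P' n), C * T ∈ costs (P n)

lemma Easier.trans {P P' P'' : (n : ℕ) → Problem (Fin n × Fin n)} (h : Easier P P')
    (h' : Easier P' P'') : Easier P P'' := by
  obtain ⟨C, hC⟩ := h
  obtain ⟨C', hC'⟩ := h'
  refine ⟨C * C', ?_⟩
  filter_upwards [hC, hC'] with n hn hn' T hT
  rw [mul_assoc]
  exact hn _ (hn' T hT)

lemma Easier.of_reduces {P P' : (n : ℕ) → Problem (Fin n × Fin n)} {p : ℝ} (hp : 0 < p)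
    (hp1 : p ≤ 1) (h : ∀ᶠ n in Filter.atTop, Reduces p (P n) (P' n)) : Easier P P' := by
  obtain ⟨C, hC⟩ := Reduces.exists_costs hp hp1
  refine ⟨C, ?_⟩
  filter_upwards [h, Filter.eventually_ge_atTop 1] with n hn hn1
  have : Nonempty (Fin n × Fin n) := ⟨(⟨0, hn1⟩, ⟨0, hn1⟩)⟩
  exact hC _ _ _ _ hn

lemma Easier.refl (P : (n : ℕ) → Problem (Fin n × Fin n)) : Easier P P :=
  ⟨1, .of_forall fun n T hT => by rwa [one_mul]⟩

lemma Easier.restrict (P : (n : ℕ) → Problem (Fin n × Fin n))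
    (S : (n : ℕ) → Set (AdjMatrix n)) : Easier (fun n => (P n).restrict (S n)) P :=
  .of_reduces one_pos le_rfl (.of_forall fun _ => .of_subset Set.inter_subset_left rfl)

lemma Easier.isBigO {P P' : (n : ℕ) → Problem (Fin n × Fin n)} (h : Easier P P')
    (h' : Easier P' P) :
    (fun n : ℕ => (Q (P n) : ℝ)) =O[Filter.atTop] (fun n : ℕ => (Q (P' n) : ℝ)) := by
  obtain ⟨C, hC⟩ := h
  obtain ⟨C', hC'⟩ := h'
  refine Asymptotics.IsBigO.of_bound C ?_
  filter_upwards [hC, hC'] with n hn hn'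
  rw [Real.norm_natCast, Real.norm_natCast]
  exact_mod_cast Q_le_of_costs hn hn'

lemma easier_of_detects {k : ℕ} (hk : 1 ≤ k) {P P' : (n : ℕ) → Problem (Fin n × Fin n)}
    (hP : ∀ n (s t : Fin n), (s : ℕ) = 0 → (t : ℕ) = 1 → DetectsWalks (k * k) k s t (P n))
    (hP' : ∀ n (s t : Fin n), (s : ℕ) = 0 → (t : ℕ) = 1 → DetectsLayered k s t (P' n)) :
    Easier P P' := by
  have h1 : (1 : ℝ) ≤ ((k * k : ℕ) : ℝ) * (k + 1) ^ (k + 1) := by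
    have : 1 ≤ k * k * (k + 1) ^ (k + 1) := Nat.mul_pos (Nat.mul_pos hk hk) (by positivity)
    exact_mod_cast this
  refine .of_reduces (p := 1 / (((k * k : ℕ) : ℝ) * (k + 1) ^ (k + 1)))
    (one_div_pos.2 (by linarith)) ((div_le_one (by linarith)).2 h1) ?_
  filter_upwards [Filter.eventually_ge_atTop (2 * k + 5)] with n hn
  let s : Fin n := ⟨0, by omega⟩
  let t : Fin n := ⟨1, by omega⟩
  exact (hP n s t rfl rfl).reduces rfl rfl hn hk (hP' n s t rfl rfl)

/-- The eight path and cycle detection problems. -/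
abbrev pathCycleProblems (k : ℕ) : Set ((n : ℕ) → Problem (Fin n × Fin n)) :=
  {DirPathEq k, DirPathLe k, PromDirPathEq k, PromDirPathLe k,
    DirCycleEq k, DirCycleLe k, PromDirCycleEq k, PromDirCycleLe k}

/-- `P₁` is `P` with its promise, if any, dropped. -/
lemma exists_easier_detectsWalks {k : ℕ} (hk : 3 ≤ k) {P : (n : ℕ) → Problem (Fin n × Fin n)}
    (hP : P ∈ pathCycleProblems k) : ∃ P₁, Easier P P₁ ∧
      ∀ n (s t : Fin n), (s : ℕ) = 0 → (t : ℕ) = 1 → DetectsWalks (k * k) k s t (P₁ n) := by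
  have pathEq : ∀ n (s t : Fin n), (s : ℕ) = 0 → (t : ℕ) = 1 →
      DetectsWalks (k * k) k s t (DirPathEq k n) := fun n s t hs ht =>
    detectsWalks_of_paths hs ht {k} (by simp) (by simp; omega) fun x => by simp [DirPathEq]
  have pathLe : ∀ n (s t : Fin n), (s : ℕ) = 0 → (t : ℕ) = 1 →
      DetectsWalks (k * k) k s t (DirPathLe k n) := fun n s t hs ht =>
    detectsWalks_of_paths hs ht (Finset.Icc 1 k) (by simp; omega) (by simp) fun x => by
      simp [DirPathLe, and_assoc]
  have cycleEq : ∀ n (s t : Fin n), (s : ℕ) = 0 → (t : ℕ) = 1 →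
      DetectsWalks (k * k) k s t (DirCycleEq k n) := fun n s t hs ht =>
    detectsWalks_of_cycles hs ht {k} (by simp) (by simp; omega) fun x => by simp [DirCycleEq]
  have cycleLe : ∀ n (s t : Fin n), (s : ℕ) = 0 → (t : ℕ) = 1 →
      DetectsWalks (k * k) k s t (DirCycleLe k n) := fun n s t hs ht =>
    detectsWalks_of_cycles hs ht (Finset.Icc 3 k) (by simp; omega) (by simp) fun x => by
      simp [DirCycleLe, and_assoc]
  rcases hP with rfl | rfl | rfl | rfl | rfl | rfl | rfl | rfl
  · exact ⟨_, .refl _, pathEq⟩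
  · exact ⟨_, .refl _, pathLe⟩
  · exact ⟨_, .restrict (DirPathEq k) _, pathEq⟩
  · exact ⟨_, .restrict (DirPathLe k) _, pathLe⟩
  · exact ⟨_, .refl _, cycleEq⟩
  · exact ⟨_, .refl _, cycleLe⟩
  · exact ⟨_, .restrict (DirCycleEq k) _, cycleEq⟩
  · exact ⟨_, .restrict (DirCycleLe k) _, cycleLe⟩

/-- `P₁` is the promise version of `P`. -/
lemma exists_detectsLayered_easier {k : ℕ} (hk : 3 ≤ k) {P : (n : ℕ) → Problem (Fin n × Fin n)}
    (hP : P ∈ pathCycleProblems k) : ∃ P₁, Easier P₁ P ∧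
      ∀ n (s t : Fin n), (s : ℕ) = 0 → (t : ℕ) = 1 → DetectsLayered k s t (P₁ n) := by
  have pathEq : ∀ n (s t : Fin n), (s : ℕ) = 0 → (t : ℕ) = 1 →
      DetectsLayered k s t (PromDirPathEq k n) := fun _ _ _ => detectsLayered_promDirPathEq
  have pathLe : ∀ n (s t : Fin n), (s : ℕ) = 0 → (t : ℕ) = 1 →
      DetectsLayered k s t (PromDirPathLe k n) := fun _ _ _ => detectsLayered_promDirPathLe hk
  have cycleEq : ∀ n (s t : Fin n), (s : ℕ) = 0 → (t : ℕ) = 1 →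
      DetectsLayered k s t (PromDirCycleEq k n) := fun _ _ _ => detectsLayered_promDirCycleEq hk
  have cycleLe : ∀ n (s t : Fin n), (s : ℕ) = 0 → (t : ℕ) = 1 →
      DetectsLayered k s t (PromDirCycleLe k n) := fun _ _ _ => detectsLayered_promDirCycleLe hk
  rcases hP with rfl | rfl | rfl | rfl | rfl | rfl | rfl | rfl
  · exact ⟨_, .restrict (DirPathEq k) _, pathEq⟩
  · exact ⟨_, .restrict (DirPathLe k) _, pathLe⟩
  · exact ⟨_, .refl _, pathEq⟩
  · exact ⟨_, .refl _, pathLe⟩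
  · exact ⟨_, .restrict (DirCycleEq k) _, cycleEq⟩
  · exact ⟨_, .restrict (DirCycleLe k) _, cycleLe⟩
  · exact ⟨_, .refl _, cycleEq⟩
  · exact ⟨_, .refl _, cycleLe⟩

/-- The chain runs from `P` to its version without promise, by colour coding to the promise version
of `P'`, and from there to `P'`. -/
lemma easier_of_mem {k : ℕ} (hk : 3 ≤ k) {P P' : (n : ℕ) → Problem (Fin n × Fin n)}
    (hP : P ∈ pathCycleProblems k) (hP' : P' ∈ pathCycleProblems k) : Easier P P' := by
  obtain ⟨P₁, h₁, hP₁⟩ := exists_easier_detectsWalks hk hP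
  obtain ⟨P₂, h₂, hP₂⟩ := exists_detectsLayered_easier hk hP'
  exact (h₁.trans (easier_of_detects (by omega) hP₁ hP₂)).trans h₂

end QueryComplexity

theorem mainTheorem8 (k : ℕ) (hk : 3 ≤ k)
    (P P' : (n : ℕ) → QueryComplexity.Problem (Fin n × Fin n))
    (hP : P ∈ ({QueryComplexity.DirPathEq k, QueryComplexity.DirPathLe k,
      QueryComplexity.PromDirPathEq k, QueryComplexity.PromDirPathLe k,
      QueryComplexity.DirCycleEq k, QueryComplexity.DirCycleLe k,
      QueryComplexity.PromDirCycleEq k, QueryComplexity.PromDirCycleLe k} :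
        Set ((n : ℕ) → QueryComplexity.Problem (Fin n × Fin n))))
    (hP' : P' ∈ ({QueryComplexity.DirPathEq k, QueryComplexity.DirPathLe k,
      QueryComplexity.PromDirPathEq k, QueryComplexity.PromDirPathLe k,
      QueryComplexity.DirCycleEq k, QueryComplexity.DirCycleLe k,
      QueryComplexity.PromDirCycleEq k, QueryComplexity.PromDirCycleLe k} :
        Set ((n : ℕ) → QueryComplexity.Problem (Fin n × Fin n)))) :
    (fun n : ℕ => (QueryComplexity.Q (P n) : ℝ)) =Θ[Filter.atTop]
      (fun n : ℕ => (QueryComplexity.Q (P' n) : ℝ)) := by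
  exact ⟨(QueryComplexity.easier_of_mem hk hP hP').isBigO (QueryComplexity.easier_of_mem hk hP' hP),
    (QueryComplexity.easier_of_mem hk hP' hP).isBigO (QueryComplexity.easier_of_mem hk hP hP')⟩
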